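/- Let $X_1=\partial_x-\frac y2\partial_z$, $X_2=\partial_y+\frac x2\partial_z$ be the orthonormal frame of the Heisenberg distribution $D=\operatorname{span}\{X_1,X_2\}$ on $\mathbb R^3$, with Popp volume $\mathcal P=dx\wedge dy\wedge dz$. Let $a\ge 0$, $a\ne\frac12$, let $S=\{z=axy\}$, $u=z-axy$, and put $\lambda^\pm=\frac12\pm a$. Let $X=(X_2u)X_1-(X_1u)X_2$ be the characteristic vector field of $S$, $\widehat X=X/\|X\|$ the unit one, $N$ the horizontal unit normal, i.e. the normalization of $(X_1u)X_1+(X_2u)X_2$, and $\mu=\mathcal P(N,\cdot,\cdot)$ the induced volume form on $S$ away from the origin. Let $\Delta_\ell=\widehat X^2+\operatorname{div}_\mu(\widehat X)\,\widehat X$ be the Laplacian along the leaves of the characteristic foliation, and let $\Delta_x$, $\Delta_y$ be $\Delta_\ell$ on the leaves formed by the positive $x$-axis and the positive $y$-axis, i.e. in the arc-length coordinates $x,y\in\mathbb R_+=(0,\infty)$ $$\Delta_x=\partial_x^2+\frac{1}{\lambda^-x}\partial_x,\qquad \Delta_y=\partial_y^2+\frac1{\lambda^+y}\partial_y .$$ Consider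 them as operators with domain $C_0^\infty(\mathbb R_+)$ (complex-valued smooth functions with compact support in $(0,\infty)$) in the complex Hilbert spaces $L^2(\mathbb R_+,x^{1/\lambda^-}dx)$ and $L^2(\mathbb R_+,y^{1/\lambda^+}dy)$, respectively. A densely defined symmetric operator is essentially self-adjoint if its closure is self-adjoint. A point of $S$ is characteristic if $D$ is tangent to $S$ there; such a point is a star node if the linearization there of $X$, as a vector field on $S$, is a nonzero multiple of the identity, a proper node if this linearization has two distinct real eigenvalues of the same sign, and a saddle if it has real eigenvalues of opposite signs. Then $\Delta_x$ and $\Delta_y$ are densely defined and symmetric, and $\Delta_y$ is not essentially self-adjoint. Moreover: - if $a=0$, the origin is a star node and $\Delta_x$ is not essentially self-adjoint; - if $0<a<\frac16$, the origin is a proper node and $\Delta_x$ is not essentially self-adjoint; - if $\frac16\le a<\frac12$, the origin is a proper node and $\Delta_x$ is essentially self-adjoint; - if $\frac12<a\le\frac32$, the origin is a saddle and $\Delta_x$ is essentially self-adjoint; - if $a>\frac32$, the origin is a saddle and $\Delta_x$ is not essentially self-adjoint. -/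

import Mathlib

open MeasureTheory Set Filter Topology
open scoped ContDiff

noncomputable section

namespace HeisenbergParaboloid

/-! ### The Heisenberg structure on `ℝ³` and the hyperbolic paraboloid `z = a x y` -/

/-- `X₁ = ∂_x - (y/2) ∂_z`. -/
def X₁ (q : ℝ × ℝ × ℝ) : ℝ × ℝ × ℝ := (1, 0, -(q.2.1 / 2))

/-- `X₂ = ∂_y + (x/2) ∂_z`. Together with `X₁` it is an orthonormal frame of the distribution. -/
def X₂ (q : ℝ × ℝ × ℝ) : ℝ × ℝ × ℝ := (0, 1, q.1 / 2)

/-- The contact distribution `D = span {X₁, X₂}`. -/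
def distribution (q : ℝ × ℝ × ℝ) : Submodule ℝ (ℝ × ℝ × ℝ) := Submodule.span ℝ {X₁ q, X₂ q}

/-- The Popp volume `dx ∧ dy ∧ dz`. -/
def poppVolume (v₁ v₂ v₃ : ℝ × ℝ × ℝ) : ℝ :=
  Matrix.det !![v₁.1, v₂.1, v₃.1; v₁.2.1, v₂.2.1, v₃.2.1; v₁.2.2, v₂.2.2, v₃.2.2]

/-- The derivative `V f` of a function `f` along a vector field `V`. -/
def along {E F : Type*} [NormedAddCommGroup E] [NormedSpace ℝ E] [NormedAddCommGroup F]
    [NormedSpace ℝ F] (V : E → E) (f : E → F) (p : E) : F := fderiv ℝ f p (V p)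

/-- The function `u = z - a x y`, whose zero locus is the surface `S`. -/
def defining (a : ℝ) (q : ℝ × ℝ × ℝ) : ℝ := q.2.2 - a * q.1 * q.2.1

/-- The global coordinates `(x, y) ↦ (x, y, a x y)` on the surface `S`. -/
def chart (a : ℝ) (p : ℝ × ℝ) : ℝ × ℝ × ℝ := (p.1, p.2, a * p.1 * p.2)

/-- The tangent space of `S` at `q ∈ S`, the kernel of `du`. -/
def tangentSpace (a : ℝ) (q : ℝ × ℝ × ℝ) : Submodule ℝ (ℝ × ℝ × ℝ) :=
  LinearMap.ker (fderiv ℝ (defining a) q).toLinearMap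

/-- The point of `S` with coordinates `p` is characteristic if the distribution is tangent
to `S` there. -/
def IsCharacteristicPoint (a : ℝ) (p : ℝ × ℝ) : Prop :=
  distribution (chart a p) = tangentSpace a (chart a p)

/-- `√((X₁u)² + (X₂u)²)`. -/
def gradNorm (a : ℝ) (q : ℝ × ℝ × ℝ) : ℝ :=
  √((along X₁ (defining a) q) ^ 2 + (along X₂ (defining a) q) ^ 2)

/-- The characteristic vector field `X = (X₂u) X₁ - (X₁u) X₂`. -/
def charField (a : ℝ) (q : ℝ × ℝ × ℝ) : ℝ × ℝ × ℝ :=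
  along X₂ (defining a) q • X₁ q - along X₁ (defining a) q • X₂ q

/-- The unitary characteristic vector field `X / ‖X‖` (away from characteristic points). -/
def unitCharField (a : ℝ) (q : ℝ × ℝ × ℝ) : ℝ × ℝ × ℝ := (gradNorm a q)⁻¹ • charField a q

/-- The horizontal unit normal `N` (away from characteristic points). -/
def horizontalNormal (a : ℝ) (q : ℝ × ℝ × ℝ) : ℝ × ℝ × ℝ :=
  (along X₁ (defining a) q / gradNorm a q) • X₁ q + (along X₂ (defining a) q / gradNorm a q) • X₂ q

/-- The density, in the coordinates `(x, y)`, of the surface volume form `μ = 𝒫(N, ·, ·)`. -/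
def surfaceDensity (a : ℝ) (p : ℝ × ℝ) : ℝ :=
  poppVolume (horizontalNormal a (chart a p)) (fderiv ℝ (chart a) p (1, 0))
    (fderiv ℝ (chart a) p (0, 1))

/-- The expression in the coordinates `(x, y)` of (the restriction to `S` of) a vector field
of `ℝ³` tangent to `S`. -/
def inCoords (a : ℝ) (Y : ℝ × ℝ × ℝ → ℝ × ℝ × ℝ) (p : ℝ × ℝ) : ℝ × ℝ :=
  ((Y (chart a p)).1, (Y (chart a p)).2.1)

/-- The divergence with respect to `μ` of a vector field on `S` given in coordinates. -/
def divergence (a : ℝ) (V : ℝ × ℝ → ℝ × ℝ) (p : ℝ × ℝ) : ℝ :=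
  (surfaceDensity a p)⁻¹ *
    (fderiv ℝ (fun p' => surfaceDensity a p' * (V p').1) p (1, 0)
      + fderiv ℝ (fun p' => surfaceDensity a p' * (V p').2) p (0, 1))

/-- The Laplacian along the leaves of the characteristic foliation,
`Δ_ℓ = div_μ ∘ ∇_ℓ = X̂² + div_μ(X̂) X̂`, on functions on `S` written in coordinates. -/
def leafLaplacian (a : ℝ) (F : ℝ × ℝ → ℂ) (p : ℝ × ℝ) : ℂ :=
  along (inCoords a (unitCharField a)) (along (inCoords a (unitCharField a)) F) p
    + (divergence a (inCoords a (unitCharField a)) p : ℂ)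
      * along (inCoords a (unitCharField a)) F p

/-- `Δ_ℓ` on the leaf `{(x, 0, 0) : x > 0}`, with arc-length coordinate `x`. A function of `x`
is extended to `S`; as `X̂` is tangent to the leaf, the extension does not matter. -/
def laplacianX (a : ℝ) (f : ℝ → ℂ) (x : ℝ) : ℂ := leafLaplacian a (fun p => f p.1) (x, 0)

/-- `Δ_ℓ` on the leaf `{(0, y, 0) : y > 0}`, with arc-length coordinate `y`. -/
def laplacianY (a : ℝ) (f : ℝ → ℂ) (y : ℝ) : ℂ := leafLaplacian a (fun p => f p.2) (0, y)

/-! ### Types of characteristic points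

They are read off the linearization of the characteristic vector field at the point. -/

/-- The linearization at `p` of the characteristic vector field, as a field on `S`. -/
def linearization (a : ℝ) (p : ℝ × ℝ) : Module.End ℝ (ℝ × ℝ) :=
  (fderiv ℝ (inCoords a (charField a)) p).toLinearMap

/-- Star node: the linearization is a nonzero multiple of the identity. -/
def IsStarNode (a : ℝ) (p : ℝ × ℝ) : Prop :=
  IsCharacteristicPoint a p ∧ ∃ r : ℝ, r ≠ 0 ∧ linearization a p = r • LinearMap.id

/-- Proper node: the linearization has distinct real eigenvalues of the same sign. -/
def IsProperNode (a : ℝ) (p : ℝ × ℝ) : Prop :=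
  IsCharacteristicPoint a p ∧ ∃ r s : ℝ, r ≠ s ∧ 0 < r * s ∧
    (linearization a p).HasEigenvalue r ∧ (linearization a p).HasEigenvalue s

/-- Saddle: the linearization has real eigenvalues of opposite signs. -/
def IsSaddle (a : ℝ) (p : ℝ × ℝ) : Prop :=
  IsCharacteristicPoint a p ∧ ∃ r s : ℝ, r * s < 0 ∧
    (linearization a p).HasEigenvalue r ∧ (linearization a p).HasEigenvalue s

/-! ### Explicit form of the two operators -/

lemma fderiv_defining (a : ℝ) (q v : ℝ × ℝ × ℝ) :
    fderiv ℝ (defining a) q v = v.2.2 - a * (v.1 * q.2.1 + q.1 * v.2.1) := by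
  have h1 : HasFDerivAt (fun q : ℝ × ℝ × ℝ => q.1) (ContinuousLinearMap.fst ℝ ℝ (ℝ × ℝ)) q :=
    hasFDerivAt_fst
  have h2 : HasFDerivAt (fun q : ℝ × ℝ × ℝ => q.2.1)
      ((ContinuousLinearMap.fst ℝ ℝ ℝ).comp (ContinuousLinearMap.snd ℝ ℝ (ℝ × ℝ))) q :=
    ((ContinuousLinearMap.fst ℝ ℝ ℝ).comp (ContinuousLinearMap.snd ℝ ℝ (ℝ × ℝ))).hasFDerivAt
  have h3 : HasFDerivAt (fun q : ℝ × ℝ × ℝ => q.2.2)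
      ((ContinuousLinearMap.snd ℝ ℝ ℝ).comp (ContinuousLinearMap.snd ℝ ℝ (ℝ × ℝ))) q :=
    ((ContinuousLinearMap.snd ℝ ℝ ℝ).comp (ContinuousLinearMap.snd ℝ ℝ (ℝ × ℝ))).hasFDerivAt
  have h := h3.sub ((h1.const_mul a).mul h2)
  have e : fderiv ℝ (defining a) q = _ := h.fderiv
  rw [e]
  simp
  ring

lemma fderiv_chart (a : ℝ) (p v : ℝ × ℝ) :
    fderiv ℝ (chart a) p v = (v.1, v.2, a * (v.1 * p.2 + p.1 * v.2)) := by
  have h1 : HasFDerivAt (fun q : ℝ × ℝ => q.1) (ContinuousLinearMap.fst ℝ ℝ ℝ) p :=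
    hasFDerivAt_fst
  have h2 : HasFDerivAt (fun q : ℝ × ℝ => q.2) (ContinuousLinearMap.snd ℝ ℝ ℝ) p :=
    hasFDerivAt_snd
  have h := h1.prodMk (h2.prodMk ((h1.const_mul a).mul h2))
  have e : fderiv ℝ (chart a) p = _ := h.fderiv
  rw [e]
  simp
  ring

lemma along_X₁ (a : ℝ) (p : ℝ × ℝ) :
    along X₁ (defining a) (chart a p) = -((1 / 2 + a) * p.2) := by
  simp only [along, fderiv_defining, X₁, chart]; ring

lemma along_X₂ (a : ℝ) (p : ℝ × ℝ) :
    along X₂ (defining a) (chart a p) = (1 / 2 - a) * p.1 := by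
  simp only [along, fderiv_defining, X₂, chart]; ring

/-- `√(α² x² + β² y²)`. -/
def radial (α β : ℝ) (p : ℝ × ℝ) : ℝ := √((α * p.1) ^ 2 + (β * p.2) ^ 2)

lemma gradNorm_chart (a : ℝ) (p : ℝ × ℝ) :
    gradNorm a (chart a p) = radial (1 / 2 - a) (1 / 2 + a) p := by
  simp only [gradNorm, along_X₁, along_X₂, radial]
  congr 1; ring

lemma inCoords_charField (a : ℝ) :
    inCoords a (charField a) = fun p => ((1 / 2 - a) * p.1, (1 / 2 + a) * p.2) := by
  funext p
  simp only [inCoords, charField, along_X₁, along_X₂, X₁, X₂]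
  simp

lemma inCoords_unitCharField (a : ℝ) :
    inCoords a (unitCharField a) = fun p =>
      ((radial (1 / 2 - a) (1 / 2 + a) p)⁻¹ * ((1 / 2 - a) * p.1),
        (radial (1 / 2 - a) (1 / 2 + a) p)⁻¹ * ((1 / 2 + a) * p.2)) := by
  funext p
  simp only [inCoords, unitCharField, charField, gradNorm_chart, along_X₁, along_X₂, X₁, X₂]
  simp

lemma surfaceDensity_eq (a : ℝ) :
    surfaceDensity a = radial (1 / 2 - a) (1 / 2 + a) := by
  funext p
  simp only [surfaceDensity, poppVolume, horizontalNormal, gradNorm_chart, along_X₁, along_X₂,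
    fderiv_chart, X₁, X₂, Matrix.det_fin_three]
  set n := radial (1 / 2 - a) (1 / 2 + a) p with hn
  have hsq : n ^ 2 = ((1 / 2 - a) * p.1) ^ 2 + ((1 / 2 + a) * p.2) ^ 2 := by
    rw [hn, radial, Real.sq_sqrt (by positivity)]
  simp [chart]
  by_cases h0 : n = 0
  · simp [h0]
  · field_simp
    rw [hsq]
    ring

lemma radial_pos {α β : ℝ} {p : ℝ × ℝ} (h : α * p.1 ≠ 0 ∨ β * p.2 ≠ 0) : 0 < radial α β p := by
  apply Real.sqrt_pos.2
  rcases h with h | h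
  · have := sq_nonneg (β * p.2); have := pow_pos (abs_pos.2 h) 2; rw [sq_abs] at this; linarith
  · have := sq_nonneg (α * p.1); have := pow_pos (abs_pos.2 h) 2; rw [sq_abs] at this; linarith

lemma differentiableAt_radial {α β : ℝ} {p : ℝ × ℝ} (h : α * p.1 ≠ 0 ∨ β * p.2 ≠ 0) :
    DifferentiableAt ℝ (radial α β) p := by
  have h0 := radial_pos h
  unfold radial at h0 ⊢
  refine DifferentiableAt.sqrt (by fun_prop) ?_
  exact (Real.sqrt_pos.1 h0).ne'

lemma continuous_radial (α β : ℝ) : Continuous (radial α β) := by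
  unfold radial; fun_prop

lemma divergence_eq (a : ℝ) {p : ℝ × ℝ} (h : (1 / 2 - a) * p.1 ≠ 0 ∨ (1 / 2 + a) * p.2 ≠ 0) :
    divergence a (inCoords a (unitCharField a)) p
      = (radial (1 / 2 - a) (1 / 2 + a) p)⁻¹ := by
  have hp := radial_pos h
  have hev : ∀ᶠ p' in 𝓝 p, radial (1 / 2 - a) (1 / 2 + a) p' ≠ 0 :=
    (continuous_radial _ _).continuousAt.eventually_ne hp.ne'
  rw [divergence, surfaceDensity_eq, inCoords_unitCharField]
  have e1 : (fun p' : ℝ × ℝ => radial (1 / 2 - a) (1 / 2 + a) p'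
      * ((radial (1 / 2 - a) (1 / 2 + a) p')⁻¹ * ((1 / 2 - a) * p'.1)))
      =ᶠ[𝓝 p] fun p' => ((1 / 2 - a) • ContinuousLinearMap.fst ℝ ℝ ℝ) p' := by
    filter_upwards [hev] with p' hp'
    rw [mul_inv_cancel_left₀ hp']
    simp
  have e2 : (fun p' : ℝ × ℝ => radial (1 / 2 - a) (1 / 2 + a) p'
      * ((radial (1 / 2 - a) (1 / 2 + a) p')⁻¹ * ((1 / 2 + a) * p'.2)))
      =ᶠ[𝓝 p] fun p' => ((1 / 2 + a) • ContinuousLinearMap.snd ℝ ℝ ℝ) p' := by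
    filter_upwards [hev] with p' hp'
    rw [mul_inv_cancel_left₀ hp']
    simp
  rw [e1.fderiv_eq, e2.fderiv_eq, ContinuousLinearMap.fderiv, ContinuousLinearMap.fderiv]
  simp
  ring_nf

lemma along_fst (V : ℝ × ℝ → ℝ × ℝ) {f : ℝ → ℂ} (hf : Differentiable ℝ f) :
    along V (fun p : ℝ × ℝ => f p.1) = fun p => ((V p).1 : ℂ) * deriv f p.1 := by
  funext p
  have h : HasFDerivAt (fun p : ℝ × ℝ => f p.1) _ p :=
    (hf p.1).hasFDerivAt.comp p (hasFDerivAt_fst (𝕜 := ℝ) (p := p))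
  rw [along, h.fderiv]
  simp [fderiv_eq_smul_deriv]

lemma along_snd (V : ℝ × ℝ → ℝ × ℝ) {f : ℝ → ℂ} (hf : Differentiable ℝ f) :
    along V (fun p : ℝ × ℝ => f p.2) = fun p => ((V p).2 : ℂ) * deriv f p.2 := by
  funext p
  have h : HasFDerivAt (fun p : ℝ × ℝ => f p.2) _ p :=
    (hf p.2).hasFDerivAt.comp p (hasFDerivAt_snd (𝕜 := ℝ) (p := p))
  rw [along, h.fderiv]
  simp [fderiv_eq_smul_deriv]

/-- The operator `Δ_x` in explicit form, `Δ_x = ∂_x² + (1 / (λ⁻ x)) ∂_x` with `λ⁻ = 1/2 - a`. -/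
lemma laplacianX_eq {a : ℝ} (ha : a ≠ 1 / 2) {f : ℝ → ℂ} (hf : ContDiff ℝ 2 f) {x : ℝ}
    (hx : x ≠ 0) :
    laplacianX a f x = deriv (deriv f) x + ((1 / ((1 / 2 - a) * x) : ℝ) : ℂ) * deriv f x := by
  set α : ℝ := 1 / 2 - a with hα
  have hα0 : α ≠ 0 := fun h => ha (by rw [hα] at h; linarith)
  have hf1 : Differentiable ℝ f := hf.differentiable (by norm_num)
  have hf2 : Differentiable ℝ (deriv f) :=
    ((contDiff_succ_iff_deriv (n := 1)).1 hf).2.2.differentiable (by norm_num)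
  have hne : α * x ≠ 0 := mul_ne_zero hα0 hx
  have hor : α * ((x, 0) : ℝ × ℝ).1 ≠ 0 ∨ (1 / 2 + a) * ((x, 0) : ℝ × ℝ).2 ≠ 0 := Or.inl hne
  have hrad : ∀ t : ℝ, radial α (1 / 2 + a) (t, 0) = |α * t| := fun t => by
    simp [radial, Real.sqrt_sq_eq_abs]
  have hV : inCoords a (unitCharField a) (x, 0) = (|α * x|⁻¹ * (α * x), 0) := by
    rw [inCoords_unitCharField, ← hα]; simp only [hrad]; simp
  have hs : (|α * x|⁻¹ * (α * x)) * (|α * x|⁻¹ * (α * x)) = 1 := by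
    have : |α * x| ≠ 0 := abs_ne_zero.2 hne
    field_simp
    rw [sq_abs]; ring_nf
  rw [laplacianX, leafLaplacian, along_fst _ hf1, divergence_eq a hor, ← hα, hrad, along, hV]
  simp only [inCoords_unitCharField, ← hα]
  set G : ℝ × ℝ → ℂ := fun p =>
    (((radial α (1 / 2 + a) p)⁻¹ * (α * p.1) : ℝ) : ℂ) * deriv f p.1 with hG
  have hGd : DifferentiableAt ℝ G (x, 0) := by
    have h1 := differentiableAt_radial hor
    have h2 : DifferentiableAt ℝ (fun p : ℝ × ℝ =>
        (radial α (1 / 2 + a) p)⁻¹ * (α * p.1)) (x, 0) :=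
      (h1.inv (radial_pos hor).ne').mul (by fun_prop)
    have h3 : DifferentiableAt ℝ (fun p : ℝ × ℝ =>
        (((radial α (1 / 2 + a) p)⁻¹ * (α * p.1) : ℝ) : ℂ)) (x, 0) :=
      Complex.ofRealCLM.differentiableAt.comp _ h2
    have h4 : DifferentiableAt ℝ (fun p : ℝ × ℝ => deriv f p.1) (x, 0) :=
      DifferentiableAt.comp (g := deriv f) ((x, 0) : ℝ × ℝ) (hf2 x) differentiableAt_fst
    exact h3.mul h4
  have hline : HasDerivAt (fun t : ℝ => ((t, 0) : ℝ × ℝ)) (1, 0) x :=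
    (hasDerivAt_id x).prodMk (hasDerivAt_const x 0)
  have hc1 : HasDerivAt (fun t => G (t, 0)) (fderiv ℝ G (x, 0) (1, 0)) x :=
    HasFDerivAt.comp_hasDerivAt (l := G) x hGd.hasFDerivAt hline
  have hloc : (fun t => G (t, 0)) =ᶠ[𝓝 x]
      fun t => ((|α * x|⁻¹ * (α * x) : ℝ) : ℂ) * deriv f t := by
    have hsgn : ∀ᶠ t in 𝓝 x, 0 < (α * t) * (α * x) := by
      have hcont : Continuous fun t : ℝ => (α * t) * (α * x) := by fun_prop
      exact hcont.continuousAt.eventually (lt_mem_nhds (mul_self_pos.2 hne))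
    filter_upwards [hsgn] with t ht
    simp only [hG, hrad]
    congr 2
    rcases lt_or_gt_of_ne hne with h | h
    · have h' : α * t < 0 := by nlinarith
      rw [abs_of_neg h, abs_of_neg h', inv_neg, inv_neg, neg_mul, neg_mul,
        inv_mul_cancel₀ h.ne, inv_mul_cancel₀ h'.ne]
    · have h' : 0 < α * t := by nlinarith
      rw [abs_of_pos h, abs_of_pos h', inv_mul_cancel₀ h.ne', inv_mul_cancel₀ h'.ne']
  have hc2 := ((hf2 x).hasDerivAt.const_mul
    ((|α * x|⁻¹ * (α * x) : ℝ) : ℂ)).congr_of_eventuallyEq hloc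
  have hd := hc1.unique hc2
  have hv : ((|α * x|⁻¹ * (α * x), 0) : ℝ × ℝ) = (|α * x|⁻¹ * (α * x)) • ((1, 0) : ℝ × ℝ) := by
    simp
  rw [hv, map_smul, hd]
  simp only [hrad, Complex.real_smul]
  rw [← mul_assoc, ← Complex.ofReal_mul, hs, ← mul_assoc, ← Complex.ofReal_mul]
  have hlast : |α * x|⁻¹ * (|α * x|⁻¹ * (α * x)) = 1 / (α * x) := by
    rw [eq_div_iff hne]
    linarith [hs]
  rw [hlast]
  simp

/-- The operator `Δ_y` in explicit form, `Δ_y = ∂_y² + (1 / (λ⁺ y)) ∂_y` with `λ⁺ = 1/2 + a`. -/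
lemma laplacianY_eq {a : ℝ} (ha : a ≠ -(1 / 2)) {f : ℝ → ℂ} (hf : ContDiff ℝ 2 f) {x : ℝ}
    (hx : x ≠ 0) :
    laplacianY a f x = deriv (deriv f) x + ((1 / ((1 / 2 + a) * x) : ℝ) : ℂ) * deriv f x := by
  set α : ℝ := 1 / 2 + a with hα
  have hα0 : α ≠ 0 := fun h => ha (by rw [hα] at h; linarith)
  have hf1 : Differentiable ℝ f := hf.differentiable (by norm_num)
  have hf2 : Differentiable ℝ (deriv f) :=
    ((contDiff_succ_iff_deriv (n := 1)).1 hf).2.2.differentiable (by norm_num)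
  have hne : α * x ≠ 0 := mul_ne_zero hα0 hx
  have hor : (1 / 2 - a) * ((0, x) : ℝ × ℝ).1 ≠ 0 ∨ α * ((0, x) : ℝ × ℝ).2 ≠ 0 := Or.inr hne
  have hrad : ∀ t : ℝ, radial (1 / 2 - a) α (0, t) = |α * t| := fun t => by
    simp [radial, Real.sqrt_sq_eq_abs]
  have hV : inCoords a (unitCharField a) (0, x) = (0, |α * x|⁻¹ * (α * x)) := by
    rw [inCoords_unitCharField, ← hα]; simp only [hrad]; simp
  have hs : (|α * x|⁻¹ * (α * x)) * (|α * x|⁻¹ * (α * x)) = 1 := by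
    have : |α * x| ≠ 0 := abs_ne_zero.2 hne
    field_simp
    rw [sq_abs]; ring_nf
  rw [laplacianY, leafLaplacian, along_snd _ hf1, divergence_eq a hor, ← hα, hrad, along, hV]
  simp only [inCoords_unitCharField, ← hα]
  set G : ℝ × ℝ → ℂ := fun p =>
    (((radial (1 / 2 - a) α p)⁻¹ * (α * p.2) : ℝ) : ℂ) * deriv f p.2 with hG
  have hGd : DifferentiableAt ℝ G (0, x) := by
    have h1 := differentiableAt_radial hor
    have h2 : DifferentiableAt ℝ (fun p : ℝ × ℝ =>
        (radial (1 / 2 - a) α p)⁻¹ * (α * p.2)) (0, x) :=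
      (h1.inv (radial_pos hor).ne').mul (by fun_prop)
    have h3 : DifferentiableAt ℝ (fun p : ℝ × ℝ =>
        (((radial (1 / 2 - a) α p)⁻¹ * (α * p.2) : ℝ) : ℂ)) (0, x) :=
      Complex.ofRealCLM.differentiableAt.comp _ h2
    have h4 : DifferentiableAt ℝ (fun p : ℝ × ℝ => deriv f p.2) (0, x) :=
      DifferentiableAt.comp (g := deriv f) ((0, x) : ℝ × ℝ) (hf2 x) differentiableAt_snd
    exact h3.mul h4
  have hline : HasDerivAt (fun t : ℝ => ((0, t) : ℝ × ℝ)) (0, 1) x :=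
    (hasDerivAt_const x 0).prodMk (hasDerivAt_id x)
  have hc1 : HasDerivAt (fun t => G (0, t)) (fderiv ℝ G (0, x) (0, 1)) x :=
    HasFDerivAt.comp_hasDerivAt (l := G) x hGd.hasFDerivAt hline
  have hloc : (fun t => G (0, t)) =ᶠ[𝓝 x]
      fun t => ((|α * x|⁻¹ * (α * x) : ℝ) : ℂ) * deriv f t := by
    have hsgn : ∀ᶠ t in 𝓝 x, 0 < (α * t) * (α * x) := by
      have hcont : Continuous fun t : ℝ => (α * t) * (α * x) := by fun_prop
      exact hcont.continuousAt.eventually (lt_mem_nhds (mul_self_pos.2 hne))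
    filter_upwards [hsgn] with t ht
    simp only [hG, hrad]
    congr 2
    rcases lt_or_gt_of_ne hne with h | h
    · have h' : α * t < 0 := by nlinarith
      rw [abs_of_neg h, abs_of_neg h', inv_neg, inv_neg, neg_mul, neg_mul,
        inv_mul_cancel₀ h.ne, inv_mul_cancel₀ h'.ne]
    · have h' : 0 < α * t := by nlinarith
      rw [abs_of_pos h, abs_of_pos h', inv_mul_cancel₀ h.ne', inv_mul_cancel₀ h'.ne']
  have hc2 := ((hf2 x).hasDerivAt.const_mul
    ((|α * x|⁻¹ * (α * x) : ℝ) : ℂ)).congr_of_eventuallyEq hloc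
  have hd := hc1.unique hc2
  have hv : ((0, |α * x|⁻¹ * (α * x)) : ℝ × ℝ) = (|α * x|⁻¹ * (α * x)) • ((0, 1) : ℝ × ℝ) := by
    simp
  rw [hv, map_smul, hd]
  simp only [hrad, Complex.real_smul]
  rw [← mul_assoc, ← Complex.ofReal_mul, hs, ← mul_assoc, ← Complex.ofReal_mul]
  have hlast : |α * x|⁻¹ * (|α * x|⁻¹ * (α * x)) = 1 / (α * x) := by
    rw [eq_div_iff hne]
    linarith [hs]
  rw [hlast]
  simp

/-! ### The operators in the weighted `L²` space of the half-line -/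

/-- The half-line `ℝ₊ = (0, ∞)`. -/
def halfLine : TopologicalSpace.Opens ℝ := ⟨Ioi 0, isOpen_Ioi⟩

/-- `C_0^∞(ℝ₊)`: complex valued smooth functions with compact support contained in `(0, ∞)`. -/
abbrev TestFun : Type := TestFunction halfLine ℂ ⊤

lemma explicit_isTest (k : ℝ) (f : TestFun) :
    ContDiff ℝ ∞ (fun x : ℝ => deriv (deriv f) x + ((1 / (k * x) : ℝ) : ℂ) * deriv f x) ∧
    HasCompactSupport (fun x : ℝ => deriv (deriv f) x + ((1 / (k * x) : ℝ) : ℂ) * deriv f x) ∧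
    tsupport (fun x : ℝ => deriv (deriv f) x + ((1 / (k * x) : ℝ) : ℂ) * deriv f x)
      ⊆ (halfLine : Set ℝ) := by
  have hd : ∀ g : ℝ → ℂ, tsupport (deriv g) ⊆ tsupport g := fun g =>
    closure_minimal support_deriv_subset (isClosed_tsupport g)
  have hsub : tsupport (fun x : ℝ =>
      deriv (deriv f) x + ((1 / (k * x) : ℝ) : ℂ) * deriv f x) ⊆ tsupport f := by
    refine closure_minimal (fun x hx => ?_) (isClosed_tsupport f)
    by_contra hxf
    have h1 : deriv f x = 0 := image_eq_zero_of_notMem_tsupport fun h => hxf (hd _ h)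
    have h2 : deriv (deriv f) x = 0 :=
      image_eq_zero_of_notMem_tsupport fun h => hxf (hd _ (hd _ h))
    exact hx (by simp [h1, h2])
  have hf : ContDiff ℝ ∞ f := f.contDiff
  have hf1 : ContDiff ℝ ∞ (deriv f) := (contDiff_infty_iff_deriv.1 hf).2
  have hf2 : ContDiff ℝ ∞ (deriv (deriv f)) := (contDiff_infty_iff_deriv.1 hf1).2
  refine ⟨contDiff_iff_contDiffAt.2 fun x => ?_,
    f.hasCompactSupport.mono' (subset_closure.trans hsub), hsub.trans f.tsupport_subset⟩
  by_cases hx : x ∈ tsupport f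
  · have hx0 : x ≠ 0 := ne_of_gt (f.tsupport_subset hx)
    refine hf2.contDiffAt.add (ContDiffAt.mul ?_ hf1.contDiffAt)
    have h : ContDiffAt ℝ ∞ (fun x : ℝ => 1 / (k * x)) x := by
      have e : (fun x : ℝ => 1 / (k * x)) = fun x => k⁻¹ * x⁻¹ := by
        funext y; rw [one_div, mul_inv]
      rw [e]
      exact contDiffAt_const.mul (contDiffAt_inv ℝ hx0)
    exact Complex.ofRealCLM.contDiff.contDiffAt.comp x h
  · have : (fun x : ℝ => deriv (deriv f) x + ((1 / (k * x) : ℝ) : ℂ) * deriv f x)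
        =ᶠ[𝓝 x] fun _ => 0 :=
      notMem_tsupport_iff_eventuallyEq.1 fun h => hx (hsub h)
    exact contDiffAt_const.congr_of_eventuallyEq this

lemma deriv_eventually_zero (f : TestFun) : ∀ᶠ x in 𝓝 (0 : ℝ), f x = 0 ∧ deriv f x = 0 := by
  have h0 : (0 : ℝ) ∉ tsupport f := fun h =>
    lt_irrefl (0 : ℝ) (mem_Ioi.1 (f.tsupport_subset h))
  have h := notMem_tsupport_iff_eventuallyEq.1 h0
  have h' := h.deriv
  filter_upwards [h, h'] with x hx hx'
  exact ⟨hx, by rw [hx']; simp⟩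

lemma differentiable_testFun (f : TestFun) : Differentiable ℝ f :=
  f.contDiff.differentiable (by simp)

lemma laplacianX_zero (a : ℝ) (f : TestFun) : laplacianX a f 0 = 0 := by
  set V := inCoords a (unitCharField a) with hV
  have h : along V (fun p : ℝ × ℝ => f p.1) =ᶠ[𝓝 ((0, 0) : ℝ × ℝ)] fun _ => 0 := by
    rw [along_fst V (differentiable_testFun f)]
    have := (continuous_fst (X := ℝ) (Y := ℝ)).continuousAt (x := ((0, 0) : ℝ × ℝ))
    filter_upwards [this.eventually (deriv_eventually_zero f)] with p hp
    rw [hp.2, mul_zero]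
  have h1 : along V (fun p : ℝ × ℝ => f p.1) (0, 0) = 0 := h.self_of_nhds
  rw [laplacianX, leafLaplacian, ← hV, h1, along, h.fderiv_eq]
  simp

lemma laplacianY_zero (a : ℝ) (f : TestFun) : laplacianY a f 0 = 0 := by
  set V := inCoords a (unitCharField a) with hV
  have h : along V (fun p : ℝ × ℝ => f p.2) =ᶠ[𝓝 ((0, 0) : ℝ × ℝ)] fun _ => 0 := by
    rw [along_snd V (differentiable_testFun f)]
    have := (continuous_snd (X := ℝ) (Y := ℝ)).continuousAt (x := ((0, 0) : ℝ × ℝ))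
    filter_upwards [this.eventually (deriv_eventually_zero f)] with p hp
    rw [hp.2, mul_zero]
  have h1 : along V (fun p : ℝ × ℝ => f p.2) (0, 0) = 0 := h.self_of_nhds
  rw [laplacianY, leafLaplacian, ← hV, h1, along, h.fderiv_eq]
  simp

/-- The coefficient vanishes identically in the degenerate case. -/
lemma laplacianX_testFun (a : ℝ) (f : TestFun) :
    laplacianX a f = if a = 1 / 2 then 0 else
      fun x => deriv (deriv f) x + ((1 / ((1 / 2 - a) * x) : ℝ) : ℂ) * deriv f x := by
  split_ifs with ha
  · funext x
    have hV : along (inCoords a (unitCharField a)) (fun p : ℝ × ℝ => f p.1) = fun _ => 0 := by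
      rw [along_fst _ (differentiable_testFun f), inCoords_unitCharField]
      funext p; simp [ha]
    rw [laplacianX, leafLaplacian, hV]
    simp [along]
  · funext x
    by_cases hx : x = 0
    · subst hx
      have h := (deriv_eventually_zero f)
      have h2 : deriv (deriv f) 0 = 0 := by
        have : deriv f =ᶠ[𝓝 (0 : ℝ)] fun _ => 0 := h.mono fun _ hx => hx.2
        rw [this.deriv_eq]; simp
      rw [laplacianX_zero, h2, h.self_of_nhds.2]; simp
    · exact laplacianX_eq ha (contDiff_infty.1 f.contDiff 2) hx

lemma laplacianY_testFun (a : ℝ) (f : TestFun) :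
    laplacianY a f = if a = -(1 / 2) then 0 else
      fun x => deriv (deriv f) x + ((1 / ((1 / 2 + a) * x) : ℝ) : ℂ) * deriv f x := by
  split_ifs with ha
  · funext x
    have hV : along (inCoords a (unitCharField a)) (fun p : ℝ × ℝ => f p.2) = fun _ => 0 := by
      rw [along_snd _ (differentiable_testFun f), inCoords_unitCharField]
      funext p; simp [ha]
    rw [laplacianY, leafLaplacian, hV]
    simp [along]
  · funext x
    by_cases hx : x = 0
    · subst hx
      have h := (deriv_eventually_zero f)
      have h2 : deriv (deriv f) 0 = 0 := by
        have : deriv f =ᶠ[𝓝 (0 : ℝ)] fun _ => 0 := h.mono fun _ hx => hx.2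
        rw [this.deriv_eq]; simp
      rw [laplacianY_zero, h2, h.self_of_nhds.2]; simp
    · exact laplacianY_eq ha (contDiff_infty.1 f.contDiff 2) hx

lemma deriv_testFun_add (f g : TestFun) : deriv (f + g : TestFun) = deriv f + deriv g := by
  funext x
  exact deriv_add (differentiable_testFun f x) (differentiable_testFun g x)

lemma deriv_testFun_smul (c : ℂ) (f : TestFun) : deriv (c • f : TestFun) = c • deriv f := by
  funext x
  exact deriv_const_smul c (differentiable_testFun f x)

lemma differentiable_deriv_testFun (f : TestFun) : Differentiable ℝ (deriv f) :=
  (contDiff_infty_iff_deriv.1 f.contDiff).2.differentiable (by simp)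

lemma explicit_add (k : ℝ) (f g : TestFun) (x : ℝ) :
    deriv (deriv (f + g : TestFun)) x + ((1 / (k * x) : ℝ) : ℂ) * deriv (f + g : TestFun) x
      = (deriv (deriv f) x + ((1 / (k * x) : ℝ) : ℂ) * deriv f x)
        + (deriv (deriv g) x + ((1 / (k * x) : ℝ) : ℂ) * deriv g x) := by
  rw [deriv_testFun_add, deriv_add (differentiable_deriv_testFun f x)
    (differentiable_deriv_testFun g x), Pi.add_apply]
  ring

lemma explicit_smul (k : ℝ) (c : ℂ) (f : TestFun) (x : ℝ) :
    deriv (deriv (c • f : TestFun)) x + ((1 / (k * x) : ℝ) : ℂ) * deriv (c • f : TestFun) x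
      = c * (deriv (deriv f) x + ((1 / (k * x) : ℝ) : ℂ) * deriv f x) := by
  rw [deriv_testFun_smul, deriv_const_smul c (differentiable_deriv_testFun f x), Pi.smul_apply,
    smul_eq_mul, smul_eq_mul]
  ring

/-- `Δ_x` as a linear map of `C_0^∞(ℝ₊)` to itself. -/
def testLaplacianX (a : ℝ) : TestFun →ₗ[ℂ] TestFun where
  toFun f :=
    { toFun := laplacianX a f
      contDiff' := by
        rw [laplacianX_testFun]; split_ifs
        · exact contDiff_const
        · exact (explicit_isTest _ f).1
      hasCompactSupport' := by
        rw [laplacianX_testFun]; split_ifs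
        · exact HasCompactSupport.zero
        · exact (explicit_isTest _ f).2.1
      tsupport_subset' := by
        rw [laplacianX_testFun]; split_ifs
        · simp
        · exact (explicit_isTest _ f).2.2 }
  map_add' f g := by
    ext x
    change laplacianX a (f + g : TestFun) x = laplacianX a f x + laplacianX a g x
    simp only [laplacianX_testFun]
    split_ifs
    · simp
    · exact explicit_add _ f g x
  map_smul' c f := by
    ext x
    change laplacianX a (c • f : TestFun) x = c * laplacianX a f x
    simp only [laplacianX_testFun]
    split_ifs
    · simp
    · exact explicit_smul _ c f x

/-- `Δ_y` as a linear map of `C_0^∞(ℝ₊)` to itself. -/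
def testLaplacianY (a : ℝ) : TestFun →ₗ[ℂ] TestFun where
  toFun f :=
    { toFun := laplacianY a f
      contDiff' := by
        rw [laplacianY_testFun]; split_ifs
        · exact contDiff_const
        · exact (explicit_isTest _ f).1
      hasCompactSupport' := by
        rw [laplacianY_testFun]; split_ifs
        · exact HasCompactSupport.zero
        · exact (explicit_isTest _ f).2.1
      tsupport_subset' := by
        rw [laplacianY_testFun]; split_ifs
        · simp
        · exact (explicit_isTest _ f).2.2 }
  map_add' f g := by
    ext x
    change laplacianY a (f + g : TestFun) x = laplacianY a f x + laplacianY a g x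
    simp only [laplacianY_testFun]
    split_ifs
    · simp
    · exact explicit_add _ f g x
  map_smul' c f := by
    ext x
    change laplacianY a (c • f : TestFun) x = c * laplacianY a f x
    simp only [laplacianY_testFun]
    split_ifs
    · simp
    · exact explicit_smul _ c f x

/-- The measure `x ^ b dx` on `(0, ∞)`. -/
def weightedMeasure (b : ℝ) : Measure ℝ :=
  (volume.restrict (Ioi 0)).withDensity fun x => ENNReal.ofReal (x ^ b)

lemma measurable_weight (b : ℝ) : Measurable fun x : ℝ => ENNReal.ofReal (x ^ b) :=
  (measurable_id.pow_const b).ennreal_ofReal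

lemma weightedMeasure_lt_top (b : ℝ) {K : Set ℝ} (hK : IsCompact K) (hK0 : K ⊆ Ioi 0) :
    weightedMeasure b K < ⊤ := by
  have hc : ContinuousOn (fun x : ℝ => x ^ b) K := fun x hx =>
    (Real.continuousAt_rpow_const x b (Or.inl (ne_of_gt (hK0 hx)))).continuousWithinAt
  have hi : IntegrableOn (fun x : ℝ => x ^ b) K := hc.integrableOn_compact hK
  rw [weightedMeasure, withDensity_apply _ hK.measurableSet,
    Measure.restrict_restrict hK.measurableSet, inter_eq_left.2 hK0]
  exact hi.lintegral_lt_top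

lemma memLp_testFun (b : ℝ) (f : TestFun) : MemLp f 2 (weightedMeasure b) := by
  have hK : IsCompact (tsupport f) := f.hasCompactSupport
  have hind : (tsupport f).indicator f = f := by
    rw [indicator_eq_self]; exact subset_tsupport f
  rw [← hind, memLp_indicator_iff_restrict (isClosed_tsupport f).measurableSet]
  obtain ⟨C, hC⟩ := f.continuous.bounded_above_of_compact_support f.hasCompactSupport
  have : IsFiniteMeasure ((weightedMeasure b).restrict (tsupport f)) :=
    ⟨by rw [Measure.restrict_apply_univ]; exact weightedMeasure_lt_top b hK f.tsupport_subset⟩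
  exact MemLp.of_bound f.continuous.aestronglyMeasurable C (ae_of_all _ hC)

/-- The inclusion of `C_0^∞(ℝ₊)` in `L²(ℝ₊, x ^ b dx)`. -/
def toL2 (b : ℝ) : TestFun →ₗ[ℂ] Lp ℂ 2 (weightedMeasure b) where
  toFun f := (memLp_testFun b f).toLp f
  map_add' _ _ := rfl
  map_smul' _ _ := rfl

lemma toL2_injective (b : ℝ) : Function.Injective (toL2 b) := by
  intro f g hfg
  have h : (f : ℝ → ℂ) =ᵐ[weightedMeasure b] g :=
    (MemLp.toLp_eq_toLp_iff (memLp_testFun b f) (memLp_testFun b g)).1 hfg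
  have hac : volume.restrict (Ioi (0 : ℝ)) ≪ weightedMeasure b := by
    refine withDensity_absolutelyContinuous' (measurable_weight b).aemeasurable ?_
    refine (ae_restrict_iff' measurableSet_Ioi).2 (ae_of_all _ fun x hx => ?_)
    exact (ENNReal.ofReal_pos.2 (Real.rpow_pos_of_pos hx b)).ne'
  have h2 := (ae_restrict_iff' measurableSet_Ioi).1 (hac.ae_le h)
  have hout : ∀ (u : TestFun) (x : ℝ), ¬ 0 < x → u x = 0 := fun u x hx =>
    image_eq_zero_of_notMem_tsupport fun h => hx (u.tsupport_subset h)
  have h3 : (f : ℝ → ℂ) =ᵐ[volume] g := by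
    filter_upwards [h2] with x hx
    by_cases h0 : 0 < x
    · exact hx h0
    · rw [hout f x h0, hout g x h0]
  have h4 := (Continuous.ae_eq_iff_eq volume f.continuous g.continuous).1 h3
  exact DFunLike.coe_injective h4

/-- The unbounded operator in `L²(ℝ₊, x ^ b dx)` with domain `C_0^∞(ℝ₊)` given by `P`. -/
def unboundedOperator (b : ℝ) (P : TestFun →ₗ[ℂ] TestFun) :
    Lp ℂ 2 (weightedMeasure b) →ₗ.[ℂ] Lp ℂ 2 (weightedMeasure b) where
  domain := LinearMap.range (toL2 b)
  toFun := (toL2 b).comp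
    (P.comp (LinearEquiv.ofInjective (toL2 b) (toL2_injective b)).symm.toLinearMap)

lemma unboundedOperator_apply (b : ℝ) (P : TestFun →ₗ[ℂ] TestFun) (f : TestFun) :
    unboundedOperator b P ⟨toL2 b f, LinearMap.mem_range_self _ f⟩ = toL2 b (P f) := by
  exact congrArg (fun g => toL2 b (P g))
    ((LinearEquiv.ofInjective (toL2 b) (toL2_injective b)).symm_apply_apply f)

/-- `Δ_x` with domain `C_0^∞(ℝ₊)` in `L²(ℝ₊, μ_x)`, `μ_x = x ^ (1 / λ⁻) dx`, `λ⁻ = 1/2 - a`. -/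
def DeltaX (a : ℝ) : Lp ℂ 2 (weightedMeasure (1 / (1 / 2 - a))) →ₗ.[ℂ]
    Lp ℂ 2 (weightedMeasure (1 / (1 / 2 - a))) :=
  unboundedOperator _ (testLaplacianX a)

/-- `Δ_y` with domain `C_0^∞(ℝ₊)` in `L²(ℝ₊, μ_y)`, `μ_y = y ^ (1 / λ⁺) dy`, `λ⁺ = 1/2 + a`. -/
def DeltaY (a : ℝ) : Lp ℂ 2 (weightedMeasure (1 / (1 / 2 + a))) →ₗ.[ℂ]
    Lp ℂ 2 (weightedMeasure (1 / (1 / 2 + a))) :=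
  unboundedOperator _ (testLaplacianY a)

/-- Densely defined symmetric operators. -/
def IsDenselySymmetric {H : Type*} [NormedAddCommGroup H] [InnerProductSpace ℂ H]
    (T : H →ₗ.[ℂ] H) : Prop :=
  Dense (T.domain : Set H) ∧ T.IsFormalAdjoint T

/-- An operator is essentially self-adjoint if it is densely defined and symmetric, and its
closure is self-adjoint. -/
def IsEssentiallySelfAdjoint {H : Type*} [NormedAddCommGroup H] [InnerProductSpace ℂ H]
    [CompleteSpace H] (T : H →ₗ.[ℂ] H) : Prop :=
  IsDenselySymmetric T ∧ IsSelfAdjoint T.closure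

end HeisenbergParaboloid

end

noncomputable section

namespace HeisenbergParaboloid

/-! ### Criteria for the self-adjointness of the closure of a symmetric operator -/

section Abstract

variable {H : Type*} [NormedAddCommGroup H] [InnerProductSpace ℂ H]

/-! Both operators have the form `L = ∂² + (b/x)∂` on `L²(x^b dx)`, with `b = 1/λ⁻` or `b = 1/λ⁺`.
Since `L u = x^(-b) (x^b u')'`, integration by parts shows that `L` is symmetric and nonpositive on
test functions. Everything then depends on `b`: for `b ≠ 1`, `L` is essentially self-adjoint exactly
when `b ≤ -1` or `3 ≤ b`.

Limit circle, `-1 < b < 3`: the solutions `1` and `x^(1-b)` of `L u = 0` are both square integrable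
near `0`. Cut off away from `0`, they lie in the domain of the adjoint, and their Lagrange bracket
at `0` is nonzero when `b ≠ 1`. So the adjoint is not symmetric, which
`inner_eq_of_isEssentiallySelfAdjoint` forbids; this is `not_isEssentiallySelfAdjoint_of_lt`.

Limit point, `b ≤ -1` or `3 ≤ b`: for a nonpositive symmetric operator it suffices that `1 - L` has
dense range (`isEssentiallySelfAdjoint_of_nonpos`), that is, that `L u = u` has no nonzero weak
solution in `L²(x^b dx)`. Weak solutions are classical solutions of `U' = x^(-b) V`, `V' = x^b U`
(`exists_solution_of_weak`). Along this system `U V` is nondecreasing, so a nonzero value of `U V`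
keeps its sign towards `∞` or towards `0`, and `U` is then too large there to be square integrable
(`eq_zero_of_system`).

The thresholds `a = 1/6` and `a = 3/2` are the values where `1/λ⁻` equals `3` and `-1`. The type of
the origin is read off the linearization, which is diagonal with entries `λ⁻`, `λ⁺`. -/

lemma adjoint_topologicalClosure (g : Submodule ℂ (H × H)) :
    g.topologicalClosure.adjoint = g.adjoint := by
  ext x
  simp only [Submodule.mem_adjoint_iff]
  refine ⟨fun h p q hpq => h p q (g.le_topologicalClosure hpq), fun h p q hpq => ?_⟩
  have hc : IsClosed {y : H × H | inner ℂ y.2 x.1 - inner ℂ y.1 x.2 = 0} :=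
    isClosed_eq (by fun_prop) continuous_const
  exact closure_minimal (fun y hy => h y.1 y.2 hy) hc hpq

/-- Pair `x - y` with `x` and apply Cauchy–Schwarz. With `y = T x` for nonpositive `T`, this bounds
the inverse of `1 - T`, so convergence of `x_n - T x_n` forces convergence of `x_n`. -/
lemma norm_le_norm_sub_of_re_inner_nonpos {x y : H} (h : (inner ℂ y x : ℂ).re ≤ 0) :
    ‖x‖ ≤ ‖x - y‖ := by
  have h1 : ‖x‖ * ‖x‖ ≤ ‖x - y‖ * ‖x‖ := by
    calc ‖x‖ * ‖x‖ = (inner ℂ x x : ℂ).re := (inner_self_eq_norm_mul_norm (𝕜 := ℂ) x).symm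
      _ ≤ (inner ℂ (x - y) x : ℂ).re := by rw [inner_sub_left, Complex.sub_re]; linarith
      _ ≤ ‖x - y‖ * ‖x‖ := (Complex.re_le_norm _).trans (norm_inner_le_norm _ _)
  rcases (norm_nonneg x).eq_or_lt with h0 | h0
  · rw [← h0]; exact norm_nonneg _
  · exact le_of_mul_le_mul_right h1 h0

variable {T : H →ₗ.[ℂ] H}

lemma dense_domain_closure (hT : IsDenselySymmetric T) :
    Dense (T.closure.domain : Set H) :=
  hT.1.mono (LinearPMap.le_closure T).1

variable [CompleteSpace H]

lemma isClosable_of_isDenselySymmetric (hT : IsDenselySymmetric T) : T.IsClosable :=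
  (LinearPMap.adjoint_isClosed hT.1).isClosable.leIsClosable (hT.2.le_adjoint hT.1)

/-- An adjoint graph is defined by closed conditions and does not change when the graph is closed.
Self-adjointness of the closure thus becomes the equality of `T.graph.adjoint` with the closure of
`T.graph`. -/
lemma graph_adjoint_closure (hT : IsDenselySymmetric T) :
    T.closure.adjoint.graph = T.graph.adjoint := by
  rw [LinearPMap.adjoint_graph_eq_graph_adjoint (dense_domain_closure hT),
    ← (isClosable_of_isDenselySymmetric hT).graph_closure_eq_closure_graph,
    adjoint_topologicalClosure]

/-- If the closure of a symmetric operator is self-adjoint, its adjoint is symmetric. -/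
lemma inner_eq_of_isEssentiallySelfAdjoint (hT : IsEssentiallySelfAdjoint T) {u u' v v' : H}
    (hu : ∀ x : T.domain, inner ℂ (T x) u = inner ℂ (x : H) u')
    (hv : ∀ x : T.domain, inner ℂ (T x) v = inner ℂ (x : H) v') :
    inner ℂ u' v = inner ℂ u v' := by
  have hmem : ∀ {u u' : H}, (∀ x : T.domain, inner ℂ (T x) u = inner ℂ (x : H) u') →
      (u, u') ∈ T.graph.adjoint := fun hu => by
    rw [Submodule.mem_adjoint_iff]
    intro p q hpq
    obtain ⟨x, rfl, rfl⟩ := (LinearPMap.mem_graph_iff T).1 hpq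
    exact sub_eq_zero.2 (hu x)
  have hu1 := hmem hu
  -- Self-adjointness moves `(u, u')` from the adjoint graph into the closure of the graph of `T`;
  -- `(v, v')` lies in the adjoint of that closure, so the two can be paired.
  rw [← graph_adjoint_closure hT.1, LinearPMap.isSelfAdjoint_def.1 hT.2,
    ← (isClosable_of_isDenselySymmetric hT.1).graph_closure_eq_closure_graph] at hu1
  have hv1 := hmem hv
  rw [← adjoint_topologicalClosure, Submodule.mem_adjoint_iff] at hv1
  exact sub_eq_zero.1 (hv1 _ _ hu1)

/-- A nonpositive symmetric operator `T` such that `1 - T` has dense range is essentially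
self-adjoint. -/
lemma isEssentiallySelfAdjoint_of_nonpos (hT : IsDenselySymmetric T)
    (hneg : ∀ x : T.domain, (inner ℂ (T x) (x : H) : ℂ).re ≤ 0)
    (hker : ∀ u : H, (∀ x : T.domain, inner ℂ u ((x : H) - T x) = 0) → u = 0) :
    IsEssentiallySelfAdjoint T := by
  refine ⟨hT, LinearPMap.isSelfAdjoint_def.2 (LinearPMap.eq_of_eq_graph ?_)⟩
  rw [graph_adjoint_closure hT,
    ← (isClosable_of_isDenselySymmetric hT).graph_closure_eq_closure_graph]
  apply le_antisymm
  · rintro ⟨u, u'⟩ hu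
    set R : Submodule ℂ H := LinearMap.range (T.domain.subtype - T.toFun)
    have hdense : R.topologicalClosure = ⊤ := by
      rw [Submodule.topologicalClosure_eq_top_iff, Submodule.eq_bot_iff]
      intro w hw
      refine hker w fun x => ?_
      exact (Submodule.mem_orthogonal' R w).1 hw _ ⟨x, rfl⟩
    -- Solve `(1 - T̄) f = u - u'` by approximation: `u - u'` is a limit of `x_n - T x_n`, and
    -- nonpositivity makes `x_n`, hence also `T x_n`, converge.
    have hy : u - u' ∈ closure (R : Set H) := by
      have : u - u' ∈ R.topologicalClosure := hdense ▸ Submodule.mem_top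
      exact this
    obtain ⟨z, hzR, hz⟩ := mem_closure_iff_seq_limit.1 hy
    choose x hx using hzR
    have hx' : ∀ n, (x n : H) - T (x n) = z n := hx
    have hcau : CauchySeq fun n => (x n : H) := by
      rw [Metric.cauchySeq_iff]
      intro ε hε
      obtain ⟨N, hN⟩ := Metric.cauchySeq_iff.1 hz.cauchySeq ε hε
      refine ⟨N, fun m hm n hn => lt_of_le_of_lt ?_ (hN m hm n hn)⟩
      rw [dist_eq_norm, dist_eq_norm]
      have := norm_le_norm_sub_of_re_inner_nonpos (hneg (x m - x n))
      rw [LinearPMap.map_sub, Submodule.coe_sub] at this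
      have e : z m - z n = (x m : H) - x n - (T (x m) - T (x n)) := by
        rw [← hx', ← hx']; abel
      rw [e]; exact this
    obtain ⟨f, hf⟩ := cauchySeq_tendsto_of_complete hcau
    have hTx : Tendsto (fun n => T (x n)) atTop (𝓝 (f - (u - u'))) := by
      have : (fun n => T (x n)) = fun n => (x n : H) - z n := by
        funext n; rw [← hx']; abel
      rw [this]; exact hf.sub hz
    have hfg : (f, f - (u - u')) ∈ T.graph.topologicalClosure :=
      mem_closure_of_tendsto (hf.prodMk_nhds hTx)
        (Eventually.of_forall fun n => LinearPMap.mem_graph T (x n))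
    -- Both `(u, u')` and `(f, f - (u - u'))` lie in the adjoint graph, with the same difference of
    -- components, so `u - f` is orthogonal to the range of `1 - T`.
    suffices u = f by
      subst this
      simpa using hfg
    rw [← sub_eq_zero]
    refine hker _ fun y => ?_
    have h1 := (Submodule.mem_adjoint_iff _ _).1 hu _ _ (LinearPMap.mem_graph T y)
    have hsub : T.graph.topologicalClosure ≤ T.graph.adjoint := by
      rw [← LinearPMap.adjoint_graph_eq_graph_adjoint hT.1]
      exact T.graph.topologicalClosure_minimal
        (LinearPMap.le_graph_iff.2 (hT.2.le_adjoint hT.1)) (LinearPMap.adjoint_isClosed hT.1)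
    have h2 := (Submodule.mem_adjoint_iff _ _).1 (hsub hfg) _ _ (LinearPMap.mem_graph T y)
    rw [← inner_conj_symm, map_eq_zero]
    simp only [inner_sub_left, inner_sub_right] at h1 h2 ⊢
    linear_combination h2 - h1
  · rw [← LinearPMap.adjoint_graph_eq_graph_adjoint hT.1]
    exact T.graph.topologicalClosure_minimal
      (LinearPMap.le_graph_iff.2 (hT.2.le_adjoint hT.1)) (LinearPMap.adjoint_isClosed hT.1)

end Abstract

/-! ### Integrals over the half-line -/

lemma integral_weightedMeasure (b : ℝ) (F : ℝ → ℂ) :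
    ∫ x, F x ∂(weightedMeasure b) = ∫ x in Ioi 0, x ^ b • F x := by
  rw [weightedMeasure, integral_withDensity_eq_integral_toReal_smul (measurable_weight b)
    (ae_of_all _ fun x => ENNReal.ofReal_lt_top)]
  refine setIntegral_congr_fun measurableSet_Ioi fun x hx => ?_
  simp only [ENNReal.toReal_ofReal (Real.rpow_nonneg (le_of_lt hx) b)]

lemma integrable_weightedMeasure_iff {E : Type*} [NormedAddCommGroup E] [NormedSpace ℝ E]
    (b : ℝ) (F : ℝ → E) {s : Set ℝ} (hs : MeasurableSet s) (hs0 : s ⊆ Ioi 0) :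
    IntegrableOn F s (weightedMeasure b) ↔ IntegrableOn (fun x => x ^ b • F x) s := by
  rw [IntegrableOn, weightedMeasure, restrict_withDensity hs, Measure.restrict_restrict hs,
    inter_eq_left.2 hs0, integrable_withDensity_iff_integrable_smul' (measurable_weight b)
    (ae_of_all _ fun x => ENNReal.ofReal_lt_top)]
  refine integrableOn_congr_fun (fun x hx => ?_) hs
  simp only [ENNReal.toReal_ofReal (Real.rpow_nonneg (le_of_lt (hs0 hx)) b)]

lemma weightedMeasure_restrict (b : ℝ) :
    (weightedMeasure b).restrict (Ioi 0) = weightedMeasure b := by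
  rw [weightedMeasure, restrict_withDensity measurableSet_Ioi,
    Measure.restrict_restrict measurableSet_Ioi, inter_self]

lemma ae_weightedMeasure_of_ae {b : ℝ} {p : ℝ → Prop} (h : ∀ᵐ x, x ∈ Ioi (0 : ℝ) → p x) :
    ∀ᵐ x ∂(weightedMeasure b), p x :=
  (withDensity_absolutelyContinuous _ _).ae_le ((ae_restrict_iff' measurableSet_Ioi).2 h)

lemma integral_Ioi_eq_sub {F F' : ℝ → ℂ} {c d : ℝ} (hc : 0 < c) (hcd : c ≤ d)
    (hF : ∀ x ∈ Icc c d, HasDerivAt F (F' x) x) (hF' : ContinuousOn F' (Icc c d))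
    (h0 : ∀ x ∈ Ioi (0 : ℝ), x ∉ Ioc c d → F' x = 0) : ∫ x in Ioi 0, F' x = F d - F c := by
  rw [setIntegral_eq_of_subset_of_forall_sdiff_eq_zero measurableSet_Ioi (s := Ioc c d)
    (fun x hx => hc.trans hx.1) (fun x hx => h0 x hx.1 hx.2),
    ← intervalIntegral.integral_of_le hcd]
  refine intervalIntegral.integral_eq_sub_of_hasDerivAt (by rwa [uIcc_of_le hcd]) ?_
  exact ContinuousOn.intervalIntegrable (by rwa [uIcc_of_le hcd])

lemma integrableOn_Ioi_of_eq_zero {F : ℝ → ℂ} {c d : ℝ} (hc : 0 < c)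
    (hF : ContinuousOn F (Ioi 0)) (h0 : ∀ x ∈ Ioi (0 : ℝ), x ∉ Icc c d → F x = 0) :
    IntegrableOn F (Ioi 0) := by
  have hsub : Icc c d ⊆ Ioi 0 := fun x hx => hc.trans_le hx.1
  have h := (hF.mono hsub).integrableOn_Icc (μ := volume)
  exact h.of_forall_sdiff_eq_zero measurableSet_Ioi fun x hx => h0 x hx.1 hx.2

lemma memLp_of_continuousOn_of_eq_zero {F : ℝ → ℂ} {b c d : ℝ} (hc : 0 < c)
    (hF : ContinuousOn F (Ioi 0)) (h0 : ∀ x ∈ Ioi (0 : ℝ), x ∉ Icc c d → F x = 0) :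
    MemLp F 2 (weightedMeasure b) := by
  have hsub : Icc c d ⊆ Ioi 0 := fun x hx => hc.trans_le hx.1
  have hac : weightedMeasure b ≪ volume.restrict (Ioi 0) := withDensity_absolutelyContinuous _ _
  have hm : AEStronglyMeasurable F (weightedMeasure b) :=
    (hF.aestronglyMeasurable measurableSet_Ioi).mono_ac hac
  rw [memLp_two_iff_integrable_sq_norm hm, ← weightedMeasure_restrict]
  refine (integrable_weightedMeasure_iff b _ measurableSet_Ioi le_rfl).2 ?_
  have hcont : ContinuousOn (fun x : ℝ => x ^ b • ‖F x‖ ^ 2) (Icc c d) := by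
    refine ContinuousOn.mul (fun x hx => ?_) ((hF.mono hsub).norm.pow 2)
    exact (Real.continuousAt_rpow_const x b (Or.inl (hsub hx).ne')).continuousWithinAt
  refine (hcont.integrableOn_Icc (μ := volume)).of_forall_sdiff_eq_zero measurableSet_Ioi
    fun x hx => ?_
  simp [h0 x hx.1 hx.2]

lemma exists_Ioo_of_isCompact {K : Set ℝ} (hK : IsCompact K) (hK0 : K ⊆ Ioi 0) :
    ∃ c d : ℝ, 0 < c ∧ c < d ∧ K ⊆ Ioo c d := by
  rcases K.eq_empty_or_nonempty with rfl | hne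
  · exact ⟨1, 2, one_pos, one_lt_two, empty_subset _⟩
  · have hm := hK.sInf_mem hne
    have hM := hK.sSup_mem hne
    have h0 : 0 < sInf K := hK0 hm
    have hle : sInf K ≤ sSup K := csInf_le hK.bddBelow hM
    exact ⟨sInf K / 2, sSup K + 1, by linarith, by linarith, fun x hx =>
      ⟨by linarith [csInf_le hK.bddBelow hx], by linarith [le_csSup hK.bddAbove hx]⟩⟩

lemma exists_Ioo_testFun (f : TestFun) : ∃ c d : ℝ, 0 < c ∧ c < d ∧
    ∀ x ∉ Ioo c d, f x = 0 ∧ deriv f x = 0 ∧ deriv (deriv f) x = 0 := by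
  obtain ⟨c, d, hc, hcd, hs⟩ := exists_Ioo_of_isCompact f.hasCompactSupport f.tsupport_subset
  have hd : ∀ g : ℝ → ℂ, tsupport (deriv g) ⊆ tsupport g := fun g =>
    closure_minimal support_deriv_subset (isClosed_tsupport g)
  refine ⟨c, d, hc, hcd, fun x hx => ⟨?_, ?_, ?_⟩⟩
  · exact image_eq_zero_of_notMem_tsupport fun h => hx (hs h)
  · exact image_eq_zero_of_notMem_tsupport fun h => hx (hs (hd _ h))
  · exact image_eq_zero_of_notMem_tsupport fun h => hx (hs (hd _ (hd _ h)))

lemma continuous_deriv_deriv_testFun (f : TestFun) : Continuous (deriv (deriv f)) :=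
  (contDiff_infty_iff_deriv.1 (contDiff_infty_iff_deriv.1 f.contDiff).2).2.continuous

lemma hasDerivAt_rpow_ofReal (b : ℝ) {x : ℝ} (hx : 0 < x) :
    HasDerivAt (fun t : ℝ => ((t ^ b : ℝ) : ℂ)) ((x ^ b : ℝ) * ((b / x : ℝ) : ℂ)) x := by
  have h := (Real.hasDerivAt_rpow_const (p := b) (Or.inl hx.ne')).ofReal_comp
  convert h using 1
  rw [Real.rpow_sub_one hx.ne']
  push_cast
  ring

lemma continuousOn_rpow_ofReal (b : ℝ) : ContinuousOn (fun t : ℝ => ((t ^ b : ℝ) : ℂ)) (Ioi 0) :=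
  fun _ hx => (hasDerivAt_rpow_ofReal b hx).continuousAt.continuousWithinAt

lemma continuousOn_div_ofReal (b : ℝ) : ContinuousOn (fun t : ℝ => ((b / t : ℝ) : ℂ)) (Ioi 0) :=
  Complex.continuous_ofReal.comp_continuousOn
    (continuousOn_const.div continuousOn_id fun _ hx => (ne_of_gt hx))

/-- Lagrange's identity: the operator `∂_x² + (b/x) ∂_x` is formally symmetric for the weight
`x ^ b`. -/
lemma integral_lagrange (b : ℝ) (φ : TestFun) {g g₁ g₂ : ℝ → ℂ}
    (hg : ∀ x, 0 < x → HasDerivAt g (g₁ x) x) (hg₁ : ∀ x, 0 < x → HasDerivAt g₁ (g₂ x) x)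
    (hg₂ : ContinuousOn g₂ (Ioi 0)) :
    ∫ x in Ioi 0, x ^ b • ((deriv (deriv φ) x + ((b / x : ℝ) : ℂ) * deriv φ x) * g x
      - φ x * (g₂ x + ((b / x : ℝ) : ℂ) * g₁ x)) = 0 := by
  obtain ⟨c, d, hc, hcd, h0⟩ := exists_Ioo_testFun φ
  have hsub : Icc c d ⊆ Ioi 0 := fun x hx => hc.trans_le hx.1
  have hgc : ContinuousOn g (Ioi 0) := fun x hx => (hg x hx).continuousAt.continuousWithinAt
  have hg₁c : ContinuousOn g₁ (Ioi 0) := fun x hx => (hg₁ x hx).continuousAt.continuousWithinAt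
  have hφ := (differentiable_testFun φ).continuous.continuousOn (s := Ioi 0)
  have hφ₁ := (differentiable_deriv_testFun φ).continuous.continuousOn (s := Ioi 0)
  have hφ₂ := (continuous_deriv_deriv_testFun φ).continuousOn (s := Ioi 0)
  -- The integrand is the derivative of the weighted Lagrange bracket, which vanishes at both
  -- endpoints because `φ` and `φ'` do.
  rw [integral_Ioi_eq_sub (F := fun x => ((x ^ b : ℝ) : ℂ) * (deriv φ x * g x - φ x * g₁ x))
    hc hcd.le]
  · obtain ⟨hd1, hd2, -⟩ := h0 d (fun h => lt_irrefl _ h.2)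
    obtain ⟨hc1, hc2, -⟩ := h0 c (fun h => lt_irrefl _ h.1)
    simp [hd1, hd2, hc1, hc2]
  · intro x hx
    have hx0 := hsub hx
    refine ((hasDerivAt_rpow_ofReal b hx0).mul
      (((differentiable_deriv_testFun φ x).hasDerivAt.mul (hg x hx0)).sub
        ((differentiable_testFun φ x).hasDerivAt.mul (hg₁ x hx0)))).congr_deriv ?_
    simp only [Complex.real_smul, Pi.sub_apply, Pi.mul_apply]
    ring
  · refine ContinuousOn.mono ?_ hsub
    simp only [Complex.real_smul]
    have h1 := continuousOn_rpow_ofReal b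
    have h2 := continuousOn_div_ofReal b
    exact h1.mul (((hφ₂.add (h2.mul hφ₁)).mul hgc).sub (hφ.mul (hg₂.add (h2.mul hg₁c))))
  · intro x _ hxcd
    obtain ⟨h1, h2, h3⟩ := h0 x fun h => hxcd ⟨h.1, h.2.le⟩
    simp [h1, h2, h3]

lemma inner_toLp (b : ℝ) {f g : ℝ → ℂ} (hf : MemLp f 2 (weightedMeasure b))
    (hg : MemLp g 2 (weightedMeasure b)) :
    inner ℂ (hf.toLp f) (hg.toLp g) =
      ∫ x in Ioi 0, x ^ b • (starRingEnd ℂ (f x) * g x) := by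
  rw [L2.inner_def, ← integral_weightedMeasure]
  refine integral_congr_ae ?_
  filter_upwards [hf.coeFn_toLp, hg.coeFn_toLp] with x h1 h2
  rw [h1, h2, RCLike.inner_apply, mul_comm]

lemma integrableOn_conj_mul {b : ℝ} {f g : ℝ → ℂ} (hf : MemLp f 2 (weightedMeasure b))
    (hg : MemLp g 2 (weightedMeasure b)) :
    IntegrableOn (fun x => x ^ b • (starRingEnd ℂ (f x) * g x)) (Ioi 0) := by
  rw [← integrable_weightedMeasure_iff b _ measurableSet_Ioi le_rfl, IntegrableOn,
    weightedMeasure_restrict]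
  exact hf.star.integrable_mul hg

/-! ### Density of the test functions -/

/-- The weight has finite mass on compact subsets of `(0, ∞)`, where `L²` is therefore contained in
`L¹`. -/
lemma locallyIntegrableOn_weight_smul {b : ℝ} {u : ℝ → ℂ} (hu : MemLp u 2 (weightedMeasure b)) :
    LocallyIntegrableOn (fun x => x ^ b • u x) (Ioi 0) := by
  rw [locallyIntegrableOn_iff isOpen_Ioi.isLocallyClosed]
  intro K hK0 hK
  rw [← integrable_weightedMeasure_iff b u hK.measurableSet hK0]
  have : IsFiniteMeasure ((weightedMeasure b).restrict K) :=
    ⟨by rw [Measure.restrict_apply_univ]; exact weightedMeasure_lt_top b hK hK0⟩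
  exact (hu.restrict K).integrable (by norm_num)

/-- A real test function, as a complex valued one. -/
def realTestFun (g : ℝ → ℝ) (h1 : ContDiff ℝ ∞ g) (h2 : HasCompactSupport g)
    (h3 : tsupport g ⊆ Ioi 0) : TestFun where
  toFun x := (g x : ℂ)
  contDiff' := Complex.ofRealCLM.contDiff.comp h1
  hasCompactSupport' := h2.comp_left Complex.ofReal_zero
  tsupport_subset' := (tsupport_comp_subset Complex.ofReal_zero g).trans h3

/-- Real test functions already suffice, by the fundamental lemma of the calculus of variations
applied to `x^b u`; the weight is then divided out. -/
lemma eq_zero_of_inner_toL2 (b : ℝ) (u : Lp ℂ 2 (weightedMeasure b))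
    (hu : ∀ φ : TestFun, inner ℂ (toL2 b φ) u = 0) : u = 0 := by
  have hmem : MemLp u 2 (weightedMeasure b) := Lp.memLp u
  have key : ∀ᵐ x, x ∈ Ioi (0 : ℝ) → x ^ b • u x = 0 := by
    refine isOpen_Ioi.ae_eq_zero_of_integral_contDiff_smul_eq_zero
      (locallyIntegrableOn_weight_smul hmem) fun g h1 h2 h3 => ?_
    have h := hu (realTestFun g h1 h2 h3)
    rw [← Lp.toLp_coeFn u hmem] at h
    change inner ℂ ((memLp_testFun b _).toLp _) _ = _ at h
    rw [inner_toLp] at h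
    rw [← h, ← setIntegral_eq_integral_of_forall_compl_eq_zero (s := Ioi 0)]
    · refine setIntegral_congr_fun measurableSet_Ioi fun x _ => ?_
      change g x • x ^ b • u x = x ^ b • (starRingEnd ℂ (g x : ℂ) * u x)
      rw [Complex.conj_ofReal, ← Complex.real_smul, smul_comm]
    · intro x hx
      rw [image_eq_zero_of_notMem_tsupport fun h => hx (h3 h), zero_smul]
  rw [Lp.eq_zero_iff_ae_eq_zero]
  refine ae_weightedMeasure_of_ae ?_
  filter_upwards [key] with x hx hx0
  exact (smul_eq_zero.1 (hx hx0)).resolve_left (Real.rpow_pos_of_pos hx0 b).ne'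

lemma dense_range_toL2 (b : ℝ) :
    Dense (LinearMap.range (toL2 b) : Set (Lp ℂ 2 (weightedMeasure b))) := by
  rw [Submodule.dense_iff_topologicalClosure_eq_top, Submodule.topologicalClosure_eq_top_iff,
    Submodule.eq_bot_iff]
  exact fun u hu => eq_zero_of_inner_toL2 b u fun φ => hu _ ⟨φ, rfl⟩

/-! ### Symmetry and semiboundedness of `∂_x² + (b/x) ∂_x` -/

section Operator

variable {b : ℝ} {P : TestFun →ₗ[ℂ] TestFun}

/-- This puts `(g, L g)` in the graph of the adjoint. No boundary condition at `0` is imposed on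
`g`, since `φ` vanishes near `0`. -/
lemma inner_operator (hP : ∀ (f : TestFun) (x : ℝ),
      P f x = deriv (deriv f) x + ((b / x : ℝ) : ℂ) * deriv f x)
    (φ : TestFun) {g g₁ g₂ : ℝ → ℂ}
    (hg : ∀ x, 0 < x → HasDerivAt g (g₁ x) x) (hg₁ : ∀ x, 0 < x → HasDerivAt g₁ (g₂ x) x)
    (hg₂ : ContinuousOn g₂ (Ioi 0)) (hm : MemLp g 2 (weightedMeasure b))
    (hm' : MemLp (fun x => g₂ x + ((b / x : ℝ) : ℂ) * g₁ x) 2 (weightedMeasure b)) :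
    inner ℂ (toL2 b (P φ)) (hm.toLp g) = inner ℂ (toL2 b φ) (hm'.toLp _) := by
  change inner ℂ ((memLp_testFun b (P φ)).toLp _) _ = inner ℂ ((memLp_testFun b φ).toLp _) _
  rw [inner_toLp, inner_toLp, ← sub_eq_zero, ← integral_sub
    (integrableOn_conj_mul (memLp_testFun b _) hm) (integrableOn_conj_mul (memLp_testFun b _) hm')]
  -- The inner product conjugates `φ`, whereas Lagrange's identity is bilinear: it is applied to the
  -- conjugate of `g`, and the result is conjugated.
  have h := integral_lagrange b φ (g := fun x => starRingEnd ℂ (g x))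
    (g₁ := fun x => starRingEnd ℂ (g₁ x)) (g₂ := fun x => starRingEnd ℂ (g₂ x))
    (fun x hx => (hg x hx).star) (fun x hx => (hg₁ x hx).star) hg₂.star
  rw [← map_eq_zero (starRingEnd ℂ), ← integral_conj, ← h]
  refine setIntegral_congr_fun measurableSet_Ioi fun x _ => ?_
  simp only [hP, Complex.real_smul, map_sub, map_mul, map_add, Complex.conj_conj,
    Complex.conj_ofReal]
  ring

lemma isDenselySymmetric_unboundedOperator (hP : ∀ (f : TestFun) (x : ℝ),
      P f x = deriv (deriv f) x + ((b / x : ℝ) : ℂ) * deriv f x) :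
    IsDenselySymmetric (unboundedOperator b P) := by
  refine ⟨dense_range_toL2 b, ?_⟩
  rintro ⟨_, φ, rfl⟩ ⟨_, ψ, rfl⟩
  rw [unboundedOperator_apply, unboundedOperator_apply]
  have e : (P ψ : ℝ → ℂ) = fun x => deriv (deriv ψ) x + ((b / x : ℝ) : ℂ) * deriv ψ x :=
    funext (hP ψ)
  have hm := memLp_testFun b (P ψ)
  rw [e] at hm
  have h := inner_operator hP φ (g := ψ) (fun x _ => (differentiable_testFun ψ x).hasDerivAt)
    (fun x _ => (differentiable_deriv_testFun ψ x).hasDerivAt)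
    (continuous_deriv_deriv_testFun ψ).continuousOn (memLp_testFun b ψ) hm
  have e2 : toL2 b (P ψ) = hm.toLp _ := by
    change (memLp_testFun b (P ψ)).toLp _ = _
    congr 1
  rw [e2]
  exact h

/-- Integrating the derivative of `x^b conj(φ') φ` gives `⟨L φ, φ⟩ = -∫ x^b |φ'|²`. -/
lemma re_inner_unboundedOperator_nonpos (hP : ∀ (f : TestFun) (x : ℝ),
      P f x = deriv (deriv f) x + ((b / x : ℝ) : ℂ) * deriv f x)
    (y : (unboundedOperator b P).domain) :
    (inner ℂ (unboundedOperator b P y) (y : Lp ℂ 2 (weightedMeasure b)) : ℂ).re ≤ 0 := by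
  obtain ⟨_, φ, rfl⟩ := y
  rw [unboundedOperator_apply]
  change (inner ℂ ((memLp_testFun b (P φ)).toLp _) ((memLp_testFun b φ).toLp _) : ℂ).re ≤ 0
  rw [inner_toLp]
  obtain ⟨c, d, hc, hcd, h0⟩ := exists_Ioo_testFun φ
  have hsub : Icc c d ⊆ Ioi 0 := fun x hx => hc.trans_le hx.1
  have hφ := (differentiable_testFun φ).continuous.continuousOn (s := Ioi 0)
  have hφ₁ := (differentiable_deriv_testFun φ).continuous.continuousOn (s := Ioi 0)
  have hw := continuousOn_rpow_ofReal b
  have hPc : ContinuousOn (P φ) (Ioi 0) := (P φ).continuous.continuousOn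
  have hA : ContinuousOn (fun x : ℝ => x ^ b • (starRingEnd ℂ (P φ x) * φ x)) (Ioi 0) := by
    simp only [Complex.real_smul]
    exact hw.mul (hPc.star.mul hφ)
  have hB : ContinuousOn (fun x : ℝ => ((x ^ b * ‖deriv φ x‖ ^ 2 : ℝ) : ℂ)) (Ioi 0) := by
    simp only [Complex.ofReal_mul]
    exact hw.mul (Complex.continuous_ofReal.comp_continuousOn (hφ₁.norm.pow 2))
  have hsum : ∫ x in Ioi 0, (x ^ b • (starRingEnd ℂ (P φ x) * φ x)
      + ((x ^ b * ‖deriv φ x‖ ^ 2 : ℝ) : ℂ)) = 0 := by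
    rw [integral_Ioi_eq_sub
      (F := fun x => ((x ^ b : ℝ) : ℂ) * (starRingEnd ℂ (deriv φ x) * φ x)) hc hcd.le]
    · simp [(h0 d (fun h => lt_irrefl _ h.2)).1, (h0 c (fun h => lt_irrefl _ h.1)).1]
    · intro x hx
      refine ((hasDerivAt_rpow_ofReal b (hsub hx)).mul
        ((differentiable_deriv_testFun φ x).hasDerivAt.star.mul
          (differentiable_testFun φ x).hasDerivAt)).congr_deriv ?_
      have : ((‖deriv φ x‖ ^ 2 : ℝ) : ℂ) = starRingEnd ℂ (deriv φ x) * deriv φ x := by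
        rw [Complex.conj_mul']; norm_cast
      rw [Complex.real_smul, Complex.ofReal_mul, this, hP]
      simp only [map_add, map_mul, Complex.conj_ofReal]
      simp only [Complex.star_def, Pi.mul_apply]
      ring
    · exact (hA.add hB).mono hsub
    · intro x _ hxcd
      obtain ⟨h1, h2, -⟩ := h0 x fun h => hxcd ⟨h.1, h.2.le⟩
      simp [h1, h2]
  have hiA := integrableOn_Ioi_of_eq_zero (d := d) hc hA fun x _ hx => by
    simp [(h0 x fun h => hx ⟨h.1.le, h.2.le⟩).1]
  have hiB := integrableOn_Ioi_of_eq_zero (d := d) hc hB fun x _ hx => by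
    simp [(h0 x fun h => hx ⟨h.1.le, h.2.le⟩).2.1]
  rw [integral_add hiA hiB, integral_complex_ofReal] at hsum
  rw [eq_neg_of_add_eq_zero_left hsum, Complex.neg_re, Complex.ofReal_re, neg_nonpos]
  exact setIntegral_nonneg measurableSet_Ioi fun x hx =>
    mul_nonneg (Real.rpow_nonneg (le_of_lt hx) b) (sq_nonneg _)

end Operator

/-! ### The limit circle case `-1 < b < 3` -/

/-- A smooth function equal to `1` on `(-∞, 1]` and to `0` on `[2, ∞)`. -/
def cutoff (x : ℝ) : ℝ := Real.smoothTransition (2 - x)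

lemma contDiff_cutoff : ContDiff ℝ ∞ cutoff :=
  Real.smoothTransition.contDiff.comp (contDiff_const.sub contDiff_id)

lemma hasDerivAt_cutoff (x : ℝ) : HasDerivAt cutoff (deriv cutoff x) x :=
  (contDiff_cutoff.differentiable (by simp) x).hasDerivAt

lemma hasDerivAt_deriv_cutoff (x : ℝ) :
    HasDerivAt (deriv cutoff) (deriv (deriv cutoff) x) x :=
  ((contDiff_infty_iff_deriv.1 contDiff_cutoff).2.differentiable (by simp) x).hasDerivAt

lemma continuous_deriv_deriv_cutoff : Continuous (deriv (deriv cutoff)) :=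
  (contDiff_infty_iff_deriv.1 (contDiff_infty_iff_deriv.1 contDiff_cutoff).2).2.continuous

lemma cutoff_of_le {x : ℝ} (hx : x ≤ 1) : cutoff x = 1 :=
  Real.smoothTransition.one_of_one_le (by linarith)

lemma cutoff_of_ge {x : ℝ} (hx : 2 ≤ x) : cutoff x = 0 :=
  Real.smoothTransition.zero_of_nonpos (by linarith)

lemma cutoff_nonneg (x : ℝ) : 0 ≤ cutoff x := Real.smoothTransition.nonneg _

lemma cutoff_le_one (x : ℝ) : cutoff x ≤ 1 := Real.smoothTransition.le_one _

/-- Outside the open interval the cutoff takes its maximum `1` or its minimum `0`, so its derivative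
vanishes there, endpoints included. -/
lemma deriv_cutoff_of_notMem {x : ℝ} (hx : x ∉ Ioo 1 2) : deriv cutoff x = 0 := by
  rcases le_or_gt x 1 with h | h
  · refine IsLocalMax.deriv_eq_zero (Eventually.of_forall fun y => ?_)
    rw [cutoff_of_le h]
    exact cutoff_le_one _
  · have h2 : 2 ≤ x := not_lt.1 fun h' => hx ⟨h, h'⟩
    refine IsLocalMin.deriv_eq_zero (Eventually.of_forall fun y => ?_)
    rw [cutoff_of_ge h2]
    exact cutoff_nonneg _

lemma deriv_deriv_cutoff_of_notMem {x : ℝ} (hx : x ∉ Icc 1 2) : deriv (deriv cutoff) x = 0 := by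
  have h : deriv cutoff =ᶠ[𝓝 x] fun _ => 0 := by
    filter_upwards [isClosed_Icc.isOpen_compl.mem_nhds hx] with y hy
    exact deriv_cutoff_of_notMem fun h => hy (Ioo_subset_Icc_self h)
  rw [h.deriv_eq, deriv_const]

/-- The function `χ x ^ s` for a cutoff `χ`. -/
def cutoffPow (s x : ℝ) : ℂ := ((cutoff x * x ^ s : ℝ) : ℂ)

/-- The derivative of `cutoffPow`. -/
def cutoffPowDeriv (s x : ℝ) : ℂ :=
  ((deriv cutoff x * x ^ s + cutoff x * (x ^ s * (s / x)) : ℝ) : ℂ)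

/-- The second derivative of `cutoffPow`. -/
def cutoffPowDeriv₂ (s x : ℝ) : ℂ :=
  ((deriv (deriv cutoff) x * x ^ s + 2 * (deriv cutoff x * (x ^ s * (s / x)))
    + cutoff x * (x ^ s * (s / x) * (s / x) + x ^ s * (-s / x ^ 2)) : ℝ) : ℂ)

lemma hasDerivAt_rpow' (s : ℝ) {x : ℝ} (hx : 0 < x) :
    HasDerivAt (fun t : ℝ => t ^ s) (x ^ s * (s / x)) x := by
  refine (Real.hasDerivAt_rpow_const (p := s) (Or.inl hx.ne')).congr_deriv ?_
  rw [Real.rpow_sub_one hx.ne']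
  ring

lemma hasDerivAt_cutoffPow (s : ℝ) {x : ℝ} (hx : 0 < x) :
    HasDerivAt (cutoffPow s) (cutoffPowDeriv s x) x :=
  ((hasDerivAt_cutoff x).mul (hasDerivAt_rpow' s hx)).ofReal_comp

lemma hasDerivAt_cutoffPowDeriv (s : ℝ) {x : ℝ} (hx : 0 < x) :
    HasDerivAt (cutoffPowDeriv s) (cutoffPowDeriv₂ s x) x := by
  have h1 : HasDerivAt (fun t : ℝ => s / t) (-s / x ^ 2) x := by
    refine ((hasDerivAt_const x s).div (hasDerivAt_id x) hx.ne').congr_deriv ?_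
    simp
  have h := ((hasDerivAt_deriv_cutoff x).mul (hasDerivAt_rpow' s hx)).add
    ((hasDerivAt_cutoff x).mul ((hasDerivAt_rpow' s hx).mul h1))
  refine HasDerivAt.ofReal_comp (h.congr_deriv ?_)
  simp only [Pi.mul_apply]
  ring

lemma continuousOn_cutoffPowDeriv₂ (s : ℝ) : ContinuousOn (cutoffPowDeriv₂ s) (Ioi 0) := by
  have hp : ContinuousOn (fun x : ℝ => x ^ s) (Ioi 0) := fun x hx =>
    (hasDerivAt_rpow' s hx).continuousAt.continuousWithinAt
  have hd : ∀ r : ℝ, ContinuousOn (fun x : ℝ => r / x) (Ioi 0) := fun r =>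
    continuousOn_const.div continuousOn_id fun x hx => (ne_of_gt hx)
  have hd2 : ContinuousOn (fun x : ℝ => -s / x ^ 2) (Ioi 0) :=
    continuousOn_const.div (continuousOn_pow 2) fun x hx => pow_ne_zero 2 (ne_of_gt hx)
  have h0 : ContinuousOn cutoff (Ioi 0) := fun x _ =>
    (hasDerivAt_cutoff x).continuousAt.continuousWithinAt
  have h1 : ContinuousOn (deriv cutoff) (Ioi 0) := fun x _ =>
    (hasDerivAt_deriv_cutoff x).continuousAt.continuousWithinAt
  have h2 := continuous_deriv_deriv_cutoff.continuousOn (s := Ioi 0)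
  refine Complex.continuous_ofReal.comp_continuousOn ?_
  exact ((h2.mul hp).add (continuousOn_const.mul (h1.mul (hp.mul (hd s))))).add
    (h0.mul (((hp.mul (hd s)).mul (hd s)).add (hp.mul hd2)))

/-- The hypothesis is the indicial equation, that is, `L x^s = 0`; only terms containing a
derivative of the cutoff survive. -/
lemma operator_cutoffPow {b s : ℝ} (hs : s * (s - 1 + b) = 0) {x : ℝ} (hx : 0 < x) :
    cutoffPowDeriv₂ s x + ((b / x : ℝ) : ℂ) * cutoffPowDeriv s x =
      ((x ^ s * (deriv (deriv cutoff) x + (2 * s + b) / x * deriv cutoff x) : ℝ) : ℂ) := by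
  rw [cutoffPowDeriv₂, cutoffPowDeriv, ← Complex.ofReal_mul, ← Complex.ofReal_add]
  congr 1
  field_simp
  linear_combination cutoff x * hs

/-- The squared density is at most `x^(b + 2s)` on `(0, 2]` and zero beyond. -/
lemma memLp_cutoffPow {b s : ℝ} (h : -1 < b + 2 * s) :
    MemLp (cutoffPow s) 2 (weightedMeasure b) := by
  have hcont : ContinuousOn (cutoffPow s) (Ioi 0) := fun x hx =>
    (hasDerivAt_cutoffPow s hx).continuousAt.continuousWithinAt
  have hm : AEStronglyMeasurable (cutoffPow s) (weightedMeasure b) :=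
    (hcont.aestronglyMeasurable measurableSet_Ioi).mono_ac (withDensity_absolutelyContinuous _ _)
  rw [memLp_two_iff_integrable_sq_norm hm, ← weightedMeasure_restrict]
  refine (integrable_weightedMeasure_iff b _ measurableSet_Ioi le_rfl).2 ?_
  have hi : IntegrableOn (fun x : ℝ => x ^ (b + 2 * s)) (Ioc 0 2) :=
    (intervalIntegrable_iff_integrableOn_Ioc_of_le zero_le_two).1
      (intervalIntegral.intervalIntegrable_rpow' h)
  have hcont' : ContinuousOn (fun x : ℝ => x ^ b • ‖cutoffPow s x‖ ^ 2) (Ioi 0) :=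
    ContinuousOn.mul (fun x hx => (hasDerivAt_rpow' b hx).continuousAt.continuousWithinAt)
      (hcont.norm.pow 2)
  have hi2 : IntegrableOn (fun x : ℝ => x ^ b • ‖cutoffPow s x‖ ^ 2) (Ioc 0 2) := by
    refine Integrable.mono' hi
      ((hcont'.mono fun x hx => hx.1).aestronglyMeasurable measurableSet_Ioc) ?_
    refine (ae_restrict_iff' measurableSet_Ioc).2 (ae_of_all _ fun x hx => ?_)
    have hx0 : 0 < x := hx.1
    have h1 : ‖cutoffPow s x‖ ≤ x ^ s := by
      rw [cutoffPow, Complex.norm_real, Real.norm_of_nonneg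
        (mul_nonneg (cutoff_nonneg _) (Real.rpow_nonneg hx0.le _))]
      exact mul_le_of_le_one_left (Real.rpow_nonneg hx0.le _) (cutoff_le_one _)
    have h2 : ‖cutoffPow s x‖ ^ 2 ≤ (x ^ s) ^ 2 := pow_le_pow_left₀ (norm_nonneg _) h1 2
    rw [smul_eq_mul, Real.norm_of_nonneg (mul_nonneg (Real.rpow_nonneg hx0.le _) (sq_nonneg _)),
      Real.rpow_add hx0, mul_comm 2 s, Real.rpow_mul hx0.le, Real.rpow_two]
    exact mul_le_mul_of_nonneg_left h2 (Real.rpow_nonneg hx0.le _)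
  refine hi2.of_forall_sdiff_eq_zero measurableSet_Ioi fun x hx => ?_
  have : 2 ≤ x := le_of_not_ge fun h => hx.2 ⟨hx.1, h⟩
  simp [cutoffPow, cutoff_of_ge this]

/-- The function is supported in `[1, 2]`, away from the singular endpoint, so no bound on `s` is
needed. -/
lemma memLp_operator_cutoffPow {b s : ℝ} (hs : s * (s - 1 + b) = 0) :
    MemLp (fun x => cutoffPowDeriv₂ s x + ((b / x : ℝ) : ℂ) * cutoffPowDeriv s x) 2
      (weightedMeasure b) := by
  refine memLp_of_continuousOn_of_eq_zero (c := 1) (d := 2) one_pos ?_ fun x hx h => ?_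
  · exact (continuousOn_cutoffPowDeriv₂ s).add ((continuousOn_div_ofReal b).mul fun x hx =>
      (hasDerivAt_cutoffPowDeriv s hx).continuousAt.continuousWithinAt)
  · rw [operator_cutoffPow hs hx, deriv_deriv_cutoff_of_notMem h,
      deriv_cutoff_of_notMem fun h' => h (Ioo_subset_Icc_self h')]
    simp

/-- In the limit circle case the operator is not essentially self-adjoint. -/
lemma not_isEssentiallySelfAdjoint_of_lt {b : ℝ} {P : TestFun →ₗ[ℂ] TestFun}
    (hP : ∀ (f : TestFun) (x : ℝ),
      P f x = deriv (deriv f) x + ((b / x : ℝ) : ℂ) * deriv f x)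
    (hb : -1 < b) (hb' : b < 3) (hb1 : b ≠ 1) :
    ¬ IsEssentiallySelfAdjoint (unboundedOperator b P) := by
  intro hT
  have hs0 : (0 : ℝ) * (0 - 1 + b) = 0 := zero_mul _
  have hs1 : (1 - b) * (1 - b - 1 + b) = 0 := by ring
  -- The indicial roots are `0` and `1 - b`. Square integrability near `0` requires `-1 < b` for the
  -- first and `-1 < 2 - b`, i.e. `b < 3`, for the second.
  have hm0 : MemLp (cutoffPow 0) 2 (weightedMeasure b) := memLp_cutoffPow (by linarith)
  have hm1 : MemLp (cutoffPow (1 - b)) 2 (weightedMeasure b) := memLp_cutoffPow (by linarith)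
  have key : ∀ {s : ℝ} (hs : s * (s - 1 + b) = 0) (hm : MemLp (cutoffPow s) 2 (weightedMeasure b))
      (x : (unboundedOperator b P).domain), inner ℂ (unboundedOperator b P x) (hm.toLp _)
        = inner ℂ (x : Lp ℂ 2 (weightedMeasure b)) ((memLp_operator_cutoffPow hs).toLp _) := by
    rintro s hs hm ⟨_, φ, rfl⟩
    rw [unboundedOperator_apply]
    exact inner_operator hP φ (fun x hx => hasDerivAt_cutoffPow s hx)
      (fun x hx => hasDerivAt_cutoffPowDeriv s hx) (continuousOn_cutoffPowDeriv₂ s) hm _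
  have h := inner_eq_of_isEssentiallySelfAdjoint hT (key hs0 hm0) (key hs1 hm1)
  rw [inner_toLp, inner_toLp, ← sub_eq_zero, ← integral_sub
    (integrableOn_conj_mul (memLp_operator_cutoffPow hs0) hm1)
    (integrableOn_conj_mul hm0 (memLp_operator_cutoffPow hs1))] at h
  have hcongr : ∀ x ∈ Ioi (0 : ℝ),
      x ^ b • (starRingEnd ℂ (cutoffPowDeriv₂ 0 x + ((b / x : ℝ) : ℂ) * cutoffPowDeriv 0 x)
          * cutoffPow (1 - b) x)
        - x ^ b • (starRingEnd ℂ (cutoffPow 0 x)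
          * (cutoffPowDeriv₂ (1 - b) x + ((b / x : ℝ) : ℂ) * cutoffPowDeriv (1 - b) x))
      = ((-(1 - b) * (2 * (cutoff x * deriv cutoff x)) : ℝ) : ℂ) := by
    intro x hx
    have hx0 : 0 < x := hx
    rw [operator_cutoffPow hs0 hx, operator_cutoffPow hs1 hx, cutoffPow, cutoffPow,
      Complex.conj_ofReal, Complex.conj_ofReal, Complex.real_smul, Complex.real_smul,
      ← Complex.ofReal_mul, ← Complex.ofReal_mul, ← Complex.ofReal_mul, ← Complex.ofReal_mul,
      ← Complex.ofReal_sub, Real.rpow_zero]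
    congr 1
    have e : x ^ b * x ^ (1 - b) = x := by
      rw [← Real.rpow_add hx0]; norm_num
    calc _ = (x ^ b * x ^ (1 - b)) / x * (-(1 - b) * (2 * (cutoff x * deriv cutoff x))) := by
          ring
      _ = _ := by rw [e, div_self hx0.ne', one_mul]
  -- The difference of the two inner products integrates to `1 - b`, the bracket of `1` and
  -- `x^(1-b)`. It vanishes only for `b = 1`, where the two powers coincide.
  rw [setIntegral_congr_fun measurableSet_Ioi hcongr,
    integral_Ioi_eq_sub (F := fun x => ((-(1 - b) * cutoff x ^ 2 : ℝ) : ℂ)) (c := 1) (d := 2)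
      one_pos one_le_two, cutoff_of_le le_rfl, cutoff_of_ge le_rfl] at h
  · norm_num at h
    exact hb1 (by exact_mod_cast (sub_eq_zero.1 h).symm)
  · intro x _
    refine HasDerivAt.ofReal_comp (((hasDerivAt_cutoff x).pow 2).const_mul _ |>.congr_deriv ?_)
    simp [mul_assoc]
  · refine Complex.continuous_ofReal.comp_continuousOn (continuousOn_const.mul
      (continuousOn_const.mul (ContinuousOn.mul ?_ ?_)))
    · exact fun x _ => (hasDerivAt_cutoff x).continuousAt.continuousWithinAt
    · exact fun x _ => (hasDerivAt_deriv_cutoff x).continuousAt.continuousWithinAt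
  · intro x _ hx
    rw [deriv_cutoff_of_notMem fun h => hx ⟨h.1, h.2.le⟩]
    simp

/-! ### Real test functions and integration by parts on the half-line -/

/-- Real valued smooth functions with compact support in `(0, ∞)`. -/
abbrev RealTestFun : Type := TestFunction halfLine ℝ ⊤

lemma differentiable_realTestFun (f : RealTestFun) : Differentiable ℝ f :=
  f.contDiff.differentiable (by simp)

lemma exists_Ioo_realTestFun (f : RealTestFun) : ∃ c d : ℝ, 0 < c ∧ c < 1 ∧ 1 < d ∧
    ∀ x ∉ Ioo c d, f x = 0 ∧ deriv f x = 0 := by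
  obtain ⟨c, d, hc, hcd, hs⟩ := exists_Ioo_of_isCompact f.hasCompactSupport f.tsupport_subset
  -- The interval is enlarged to contain `1`, the base point of the primitives used below.
  refine ⟨min c (1 / 2), max d 2, by positivity, (min_le_right _ _).trans_lt (by norm_num),
    lt_max_of_lt_right one_lt_two, fun x hx => ?_⟩
  have hx' : x ∉ tsupport f := fun h =>
    hx ⟨(min_le_left _ _).trans_lt (hs h).1, (hs h).2.trans_le (le_max_left _ _)⟩
  exact ⟨image_eq_zero_of_notMem_tsupport hx', image_eq_zero_of_notMem_tsupport fun h =>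
    hx' (closure_minimal support_deriv_subset (isClosed_tsupport f) h)⟩

lemma integrableOn_mul_realTestFun {h : ℝ → ℝ} (hh : LocallyIntegrableOn h (Ioi 0))
    (η : RealTestFun) : IntegrableOn (fun x => h x * η x) (Ioi 0) := by
  obtain ⟨c, d, hc, -, -, h0⟩ := exists_Ioo_realTestFun η
  have hi : IntegrableOn (fun x => h x * η x) (Icc c d) :=
    (hh.integrableOn_compact_subset (fun x hx => hc.trans_le hx.1) isCompact_Icc).mul_continuousOn
      η.continuous.continuousOn isCompact_Icc
  refine hi.of_forall_sdiff_eq_zero measurableSet_Ioi fun x hx => ?_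
  rw [(h0 x fun h => hx.2 (Ioo_subset_Icc_self h)).1, mul_zero]

/-- The distribution on the half-line given by a locally integrable function. -/
def pairing (h : ℝ → ℝ) (hh : LocallyIntegrableOn h (Ioi 0)) : RealTestFun →ₗ[ℝ] ℝ where
  toFun η := ∫ x in Ioi 0, h x * η x
  map_add' η ζ := by
    rw [← integral_add (integrableOn_mul_realTestFun hh η)
      (integrableOn_mul_realTestFun hh ζ)]
    exact integral_congr_ae (ae_of_all _ fun x => mul_add _ _ _)
  map_smul' c η := by
    rw [RingHom.id_apply, smul_eq_mul, ← integral_const_mul]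
    exact integral_congr_ae (ae_of_all _ fun x => mul_left_comm _ _ _)

lemma ae_eq_zero_of_pairing {h : ℝ → ℝ} (hh : LocallyIntegrableOn h (Ioi 0))
    (h0 : ∀ η : RealTestFun, ∫ x in Ioi 0, h x * η x = 0) :
    ∀ᵐ x, x ∈ Ioi (0 : ℝ) → h x = 0 := by
  refine isOpen_Ioi.ae_eq_zero_of_integral_contDiff_smul_eq_zero hh fun g h1 h2 h3 => ?_
  rw [← h0 ⟨g, h1, h2, h3⟩, ← setIntegral_eq_integral_of_forall_compl_eq_zero (s := Ioi 0)]
  · exact setIntegral_congr_fun measurableSet_Ioi fun x _ => mul_comm _ _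
  · intro x hx
    rw [image_eq_zero_of_notMem_tsupport fun h => hx (h3 h), zero_smul]

lemma intervalIntegrable_of_locallyIntegrableOn {h : ℝ → ℝ} (hh : LocallyIntegrableOn h (Ioi 0))
    {c d : ℝ} (hc : 0 < c) (hd : 0 < d) : IntervalIntegrable h volume c d :=
  (hh.integrableOn_compact_subset (fun _ hx => (lt_min hc hd).trans_le hx.1)
    isCompact_uIcc).intervalIntegrable

lemma continuousOn_primitive {h : ℝ → ℝ} (hh : LocallyIntegrableOn h (Ioi 0)) :
    ContinuousOn (fun x => ∫ t in (1 : ℝ)..x, h t) (Ioi 0) := by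
  intro x hx
  have hx0 : 0 < x := hx
  have hc : 0 < min (x / 2) 1 := by positivity
  have hcd : min (x / 2) 1 ≤ max (x + 1) 1 := (min_le_right _ _).trans (le_max_right _ _)
  have h1 := (intervalIntegrable_of_locallyIntegrableOn hh hc
    (lt_max_of_lt_right one_pos)).absolutelyContinuousOnInterval_intervalIntegral (c := 1)
    (by rw [uIcc_of_le hcd]; exact ⟨min_le_right _ _, le_max_right _ _⟩)
  have h2 := h1.continuousOn
  rw [uIcc_of_le hcd] at h2
  refine (h2.continuousAt (Icc_mem_nhds ?_ ?_)).continuousWithinAt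
  · exact (min_le_left _ _).trans_lt (by linarith)
  · exact lt_of_lt_of_le (by linarith) (le_max_left _ _)

lemma hasDerivAt_primitive {h : ℝ → ℝ} (hh : ContinuousOn h (Ioi 0)) {x : ℝ} (hx : 0 < x) :
    HasDerivAt (fun x => ∫ t in (1 : ℝ)..x, h t) (h x) x :=
  intervalIntegral.integral_hasDerivAt_right
    (intervalIntegrable_of_locallyIntegrableOn (hh.locallyIntegrableOn measurableSet_Ioi)
      one_pos hx)
    (hh.stronglyMeasurableAtFilter isOpen_Ioi x hx) (hh.continuousAt (Ioi_mem_nhds hx))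

/-- Integration by parts against a test function. -/
lemma integral_mul_realTestFun {h : ℝ → ℝ} (hh : LocallyIntegrableOn h (Ioi 0))
    (φ : RealTestFun) :
    ∫ x in Ioi 0, h x * φ x = -∫ x in Ioi 0, (∫ t in (1 : ℝ)..x, h t) * deriv φ x := by
  obtain ⟨c, d, hc, hc1, hd1, h0⟩ := exists_Ioo_realTestFun φ
  have hcd : c ≤ d := (hc1.trans hd1).le
  have hii := intervalIntegrable_of_locallyIntegrableOn hh hc (hc.trans_le hcd)
  have h1 : (1 : ℝ) ∈ uIcc c d := by rw [uIcc_of_le hcd]; exact ⟨hc1.le, hd1.le⟩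
  have hG := hii.absolutelyContinuousOnInterval_intervalIntegral h1
  have hφ : AbsolutelyContinuousOnInterval φ c d :=
    ((φ.contDiff.of_le (by simp)).contDiffOn).absolutelyContinuousOnInterval
  have hparts := hφ.integral_mul_deriv_eq_deriv_mul hG
  rw [(h0 d fun h => lt_irrefl _ h.2).1, (h0 c fun h => lt_irrefl _ h.1).1] at hparts
  have hset : ∀ F : ℝ → ℝ, (∀ x ∉ Ioo c d, F x = 0) →
      ∫ x in Ioi 0, F x = ∫ x in c..d, F x := fun F hF => by
    rw [setIntegral_eq_of_subset_of_forall_sdiff_eq_zero measurableSet_Ioi (s := Ioc c d)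
      (fun x hx => hc.trans hx.1) (fun x hx => hF x fun h => hx.2 ⟨h.1, h.2.le⟩),
      ← intervalIntegral.integral_of_le hcd]
  rw [hset _ fun x hx => by rw [(h0 x hx).1, mul_zero],
    hset _ fun x hx => by rw [(h0 x hx).2, mul_zero]]
  -- As `h` is only locally integrable, its primitive is absolutely continuous and has derivative
  -- `h` almost everywhere, which is enough for integration by parts.
  have e1 : ∫ x in c..d, h x * φ x =
      ∫ x in c..d, φ x * deriv (fun x => ∫ t in (1 : ℝ)..x, h t) x := by
    refine intervalIntegral.integral_congr_ae ?_
    filter_upwards [hii.ae_hasDerivAt_integral] with x hx hxcd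
    rw [(hx (uIoc_subset_uIcc hxcd) 1 h1).deriv, mul_comm]
  rw [e1, hparts, zero_mul, zero_mul, sub_zero, zero_sub]
  simp only [mul_comm]

/-- The primitive from `0` vanishes to the left of the support, and to the right of it because the
total integral is zero. -/
lemma exists_antideriv_realTestFun (η : RealTestFun) (h0 : ∫ x in Ioi 0, η x = 0) :
    ∃ ψ : RealTestFun, ∀ x, HasDerivAt ψ (η x) x := by
  obtain ⟨c, d, hc, hc1, hd1, hη⟩ := exists_Ioo_realTestFun η
  set F : ℝ → ℝ := fun x => ∫ t in (0 : ℝ)..x, η t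
  have hd : ∀ x, HasDerivAt F (η x) x := fun x =>
    intervalIntegral.integral_hasDerivAt_right (η.continuous.intervalIntegrable _ _)
      (η.continuous.stronglyMeasurableAtFilter _ _) η.continuous.continuousAt
  have hsupp : Function.support F ⊆ Icc c d := by
    intro x hx
    by_contra hxcd
    refine hx ?_
    rcases lt_or_ge x c with h | h
    · change ∫ t in (0 : ℝ)..x, η t = 0
      refine (intervalIntegral.integral_congr (g := fun _ => 0) fun t ht => ?_).trans
        intervalIntegral.integral_zero
      exact (hη t fun h' => absurd h'.1 (not_lt.2 (ht.2.trans (max_le hc.le h.le)))).1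
    · have hdx : d ≤ x := le_of_not_ge fun h' => hxcd ⟨h, h'⟩
      change ∫ t in (0 : ℝ)..x, η t = 0
      refine Eq.trans ?_ h0
      rw [intervalIntegral.integral_of_le (hc.le.trans h),
        setIntegral_eq_of_subset_of_forall_sdiff_eq_zero measurableSet_Ioi
          (s := Ioc 0 x) (fun t ht => ht.1)]
      intro t ht
      exact (hη t fun h' => ht.2 ⟨ht.1, (h'.2.trans_le hdx).le⟩).1
  have htsupp : tsupport F ⊆ Icc c d := closure_minimal hsupp isClosed_Icc
  have hsmooth : ContDiff ℝ ∞ F := by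
    refine contDiff_infty_iff_deriv.2 ⟨fun x => (hd x).differentiableAt, ?_⟩
    rw [show deriv F = η from funext fun x => (hd x).deriv]
    exact η.contDiff
  exact ⟨⟨F, hsmooth, HasCompactSupport.of_support_subset_isCompact isCompact_Icc hsupp,
    htsupp.trans fun x hx => hc.trans_le hx.1⟩, hd⟩

lemma exists_rpow_mul_realTestFun (b : ℝ) (ψ : RealTestFun) :
    ∃ ρ : RealTestFun, ∀ x, ρ x = x ^ b * ψ x := by
  have hsub : tsupport (fun x : ℝ => x ^ b * ψ x) ⊆ tsupport ψ := tsupport_mul_subset_right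
  refine ⟨⟨fun x => x ^ b * ψ x, contDiff_iff_contDiffAt.2 fun x => ?_,
    ψ.hasCompactSupport.mul_left, hsub.trans ψ.tsupport_subset⟩, fun x => rfl⟩
  by_cases hx : x ∈ tsupport ψ
  · have hx0 : x ≠ 0 := ne_of_gt (ψ.tsupport_subset hx)
    exact (Real.contDiffAt_rpow_const_of_ne hx0).mul ψ.contDiff.contDiffAt
  · exact contDiffAt_const.congr_of_eventuallyEq
      (notMem_tsupport_iff_eventuallyEq.1 fun h => hx (hsub h))

/-! ### Regularity of weak solutions -/

lemma continuousOn_rpow (b : ℝ) : ContinuousOn (fun x : ℝ => x ^ b) (Ioi 0) := fun _ hx =>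
  (hasDerivAt_rpow' b hx).continuousAt.continuousWithinAt

/-- A weak solution `u` of `u'' + (b/x) u' = u` is a classical solution of the corresponding first
order system. -/
lemma exists_solution_of_weak {b : ℝ} {u : ℝ → ℝ}
    (hu : LocallyIntegrableOn (fun x => x ^ b * u x) (Ioi 0))
    (hweak : ∀ φ : RealTestFun, ∫ x in Ioi 0,
      x ^ b * u x * (φ x - (deriv (deriv φ) x + b / x * deriv φ x)) = 0) :
    ∃ U V : ℝ → ℝ, (∀ x, 0 < x → HasDerivAt U (x ^ (-b) * V x) x) ∧
      (∀ x, 0 < x → HasDerivAt V (x ^ b * U x) x) ∧ ∀ᵐ x, x ∈ Ioi (0 : ℝ) → u x = U x := by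
  have hinv : ∀ x : ℝ, 0 < x → x ^ (-b) * x ^ b = 1 := fun x hx => by
    rw [← Real.rpow_add hx, neg_add_cancel, Real.rpow_zero]
  -- With `G`, `K` and `p` as below, `K` is a particular solution of `(x^b w')' = x^b u`, while `1`
  -- and `p` span the solutions of `(x^b w')' = 0`. The goal is that `u - K` is a combination of `1`
  -- and `p`.
  set G : ℝ → ℝ := fun x => ∫ t in (1 : ℝ)..x, t ^ b * u t
  have hGc : ContinuousOn G (Ioi 0) := continuousOn_primitive hu
  have hwGc : ContinuousOn (fun x => x ^ (-b) * G x) (Ioi 0) := (continuousOn_rpow (-b)).mul hGc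
  set K : ℝ → ℝ := fun x => ∫ t in (1 : ℝ)..x, t ^ (-b) * G t
  set p : ℝ → ℝ := fun x => ∫ t in (1 : ℝ)..x, t ^ (-b)
  have hKd : ∀ x, 0 < x → HasDerivAt K (x ^ (-b) * G x) x := fun x hx =>
    hasDerivAt_primitive hwGc hx
  have hpd : ∀ x, 0 < x → HasDerivAt p (x ^ (-b)) x := fun x hx =>
    hasDerivAt_primitive (continuousOn_rpow (-b)) hx
  have hli : ∀ {F : ℝ → ℝ}, ContinuousOn F (Ioi 0) → LocallyIntegrableOn F (Ioi 0) := fun hF =>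
    hF.locallyIntegrableOn measurableSet_Ioi
  have hKi := hli fun x hx => (hKd x hx).continuousAt.continuousWithinAt
  have hpi := hli fun x hx => (hpd x hx).continuousAt.continuousWithinAt
  have h1i : LocallyIntegrableOn (fun _ : ℝ => (1 : ℝ)) (Ioi 0) := hli continuousOn_const
  have hui : LocallyIntegrableOn u (Ioi 0) := by
    have h := hu.continuousOn_mul (continuousOn_rpow (-b)) isOpen_Ioi.isLocallyClosed
    rw [locallyIntegrableOn_iff isOpen_Ioi.isLocallyClosed] at h ⊢
    intro k hk hkc
    refine (h k hk hkc).congr_fun (fun x hx => ?_) hkc.measurableSet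
    simp only
    rw [← mul_assoc, hinv x (hk hx), one_mul]
  -- A du Bois-Reymond argument: a functional vanishing on the common kernel of finitely many
  -- functionals is a linear combination of them.
  have hspan := mem_span_of_iInf_ker_le_ker (K := pairing (fun x => u x - K x) (hui.sub hKi))
    (L := ![pairing _ h1i, pairing p hpi]) (by
      intro η hη
      rw [Submodule.mem_iInf] at hη
      have e1 : ∫ x in Ioi 0, η x = 0 := by
        have : ∫ x in Ioi 0, 1 * η x = 0 := hη 0
        simpa using this
      have e2 : ∫ x in Ioi 0, p x * η x = 0 := hη 1
      change ∫ x in Ioi 0, (u x - K x) * η x = 0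
      -- The two vanishing moments allow solving `(x^b φ')' = η` with a test function `φ`: first `ψ
      -- = x^b φ'`, then `ρ = φ' = x^(-b) ψ`, then `φ`.
      obtain ⟨ψ, hψ⟩ := exists_antideriv_realTestFun η e1
      have hψ' : deriv ψ = η := funext fun x => (hψ x).deriv
      obtain ⟨ρ, hρ⟩ := exists_rpow_mul_realTestFun (-b) ψ
      have e3 : ∫ x in Ioi 0, ρ x = 0 := by
        simp only [hρ]
        rw [integral_mul_realTestFun (hli (continuousOn_rpow (-b))), hψ', e2, neg_zero]
      obtain ⟨φ, hφ⟩ := exists_antideriv_realTestFun ρ e3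
      have hφ' : deriv φ = ρ := funext fun x => (hφ x).deriv
      have hρd : ∀ x, 0 < x → deriv ρ x = x ^ (-b) * (-b / x) * ψ x + x ^ (-b) * η x :=
        fun x hx => by
          rw [show (ρ : ℝ → ℝ) = fun x => x ^ (-b) * ψ x from funext hρ]
          exact ((hasDerivAt_rpow' (-b) hx).mul (hψ x)).deriv
      -- The weak equation tested on `φ`. Two integrations by parts turn `∫ x^b u φ` into `∫ K η`.
      have e4 : ∫ x in Ioi 0, (x ^ b * u x * φ x - u x * η x) = 0 := by
        refine (setIntegral_congr_fun measurableSet_Ioi fun x hx => ?_).trans (hweak φ)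
        simp only [hφ', hρd x hx, hρ]
        linear_combination u x * η x * hinv x hx
      rw [integral_sub (integrableOn_mul_realTestFun hu φ)
        (integrableOn_mul_realTestFun hui η), integral_mul_realTestFun hu, hφ'] at e4
      have e5 : ∫ x in Ioi 0, G x * ρ x = -∫ x in Ioi 0, K x * η x := by
        have := integral_mul_realTestFun (hli hwGc) ψ
        rw [hψ'] at this
        rw [← this]
        refine setIntegral_congr_fun measurableSet_Ioi fun x hx => ?_
        simp only [hρ]
        ring
      simp only [sub_mul]
      rw [integral_sub (integrableOn_mul_realTestFun hui η)
        (integrableOn_mul_realTestFun hKi η)]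
      linarith)
  obtain ⟨k, hk⟩ := (Submodule.mem_span_range_iff_exists_fun ℝ).1 hspan
  rw [Fin.sum_univ_two] at hk
  set U : ℝ → ℝ := fun x => K x + k 0 + k 1 * p x with hU
  have hUd : ∀ x, 0 < x → HasDerivAt U (x ^ (-b) * (G x + k 1)) x := fun x hx => by
    refine (((hKd x hx).add_const (k 0)).add ((hpd x hx).const_mul (k 1))).congr_deriv ?_
    ring
  have hUc : ContinuousOn U (Ioi 0) := fun x hx => (hUd x hx).continuousAt.continuousWithinAt
  have hae : ∀ᵐ x, x ∈ Ioi (0 : ℝ) → u x = U x := by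
    have := ae_eq_zero_of_pairing (h := fun x => u x - U x) (hui.sub (hli hUc)) fun η => by
      have h := LinearMap.congr_fun hk η
      change k 0 * (∫ x in Ioi 0, 1 * η x) + k 1 * (∫ x in Ioi 0, p x * η x)
        = ∫ x in Ioi 0, (u x - K x) * η x at h
      have i1 := integrableOn_mul_realTestFun h1i η
      have i2 := integrableOn_mul_realTestFun hpi η
      have i3 : IntegrableOn (fun x => (u x - K x) * η x) (Ioi 0) :=
        integrableOn_mul_realTestFun (hui.sub hKi) η
      have i4 : IntegrableOn (fun x => k 0 * (1 * η x) + k 1 * (p x * η x)) (Ioi 0) :=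
        (i1.const_mul _).add (i2.const_mul _)
      rw [← sub_eq_zero, ← integral_const_mul, ← integral_const_mul,
        ← integral_add (i1.const_mul _) (i2.const_mul _),
        ← integral_sub i4 i3] at h
      rw [← neg_eq_zero, ← integral_neg]
      refine (integral_congr_ae (ae_of_all _ fun x => ?_)).trans h
      simp only [hU]
      ring
    filter_upwards [this] with x hx hx0
    exact sub_eq_zero.1 (hx hx0)
  refine ⟨U, fun x => G x + k 1, hUd, fun x hx => ?_, hae⟩
  -- Bootstrap: `u` may be replaced by its continuous representative `U` under the integral, so `G`
  -- is differentiable at every point.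
  have hGe : ∀ x, 0 < x → G x = ∫ t in (1 : ℝ)..x, t ^ b * U t := fun x hx => by
    refine intervalIntegral.integral_congr_ae ?_
    filter_upwards [hae] with t ht htx
    rw [ht (mem_Ioi.2 ((lt_min one_pos hx).trans htx.1))]
  have hGd : HasDerivAt G (x ^ b * U x) x :=
    (hasDerivAt_primitive ((continuousOn_rpow b).mul hUc) hx).congr_of_eventuallyEq <| by
      filter_upwards [Ioi_mem_nhds hx] with y hy
      exact hGe y hy
  exact hGd.add_const _

/-! ### The limit point case `b ≤ -1` or `3 ≤ b` -/

section FirstOrderSystem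

variable {b : ℝ} {U V : ℝ → ℝ}

lemma lt_neg_one_of_rpow_le (hi : IntegrableOn (fun x => x ^ b * U x ^ 2) (Ioi 0)) {k r : ℝ}
    (hk : 0 < k) (h : ∀ᶠ x in atTop, k * x ^ r ≤ x ^ b * U x ^ 2) : r < -1 := by
  obtain ⟨c, hc0, hc⟩ := ((eventually_gt_atTop (0 : ℝ)).and
    (eventually_forall_ge_atTop.2 h)).exists
  rw [← integrableOn_Ioi_rpow_iff hc0]
  have hsub : Ioi c ⊆ Ioi 0 := fun x hx => hc0.trans hx
  refine Integrable.mono' ((hi.mono_set hsub).const_mul k⁻¹)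
    (((continuousOn_rpow r).mono hsub).aestronglyMeasurable measurableSet_Ioi) ?_
  refine (ae_restrict_iff' measurableSet_Ioi).2 (ae_of_all _ fun x hx => ?_)
  rw [Real.norm_of_nonneg (Real.rpow_nonneg (le_of_lt (hsub hx)) r), inv_mul_eq_div,
    le_div_iff₀ hk, mul_comm]
  exact hc x (le_of_lt hx)

lemma neg_one_lt_of_rpow_le (hi : IntegrableOn (fun x => x ^ b * U x ^ 2) (Ioi 0)) {k r : ℝ}
    (hk : 0 < k) (h : ∀ᶠ x in 𝓝[>] 0, k * x ^ r ≤ x ^ b * U x ^ 2) : -1 < r := by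
  obtain ⟨c, hc0, hc⟩ := mem_nhdsGT_iff_exists_Ioo_subset.1 h
  have hc0 : 0 < c := hc0
  rw [← intervalIntegral.integrableOn_Ioo_rpow_iff hc0]
  have hsub : Ioo 0 c ⊆ Ioi 0 := fun x hx => hx.1
  refine Integrable.mono' ((hi.mono_set hsub).const_mul k⁻¹)
    (((continuousOn_rpow r).mono hsub).aestronglyMeasurable measurableSet_Ioo) ?_
  refine (ae_restrict_iff' measurableSet_Ioo).2 (ae_of_all _ fun x hx => ?_)
  rw [Real.norm_of_nonneg (Real.rpow_nonneg (le_of_lt (hsub hx)) r), inv_mul_eq_div,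
    le_div_iff₀ hk, mul_comm]
  exact hc hx

/-- If `U ≥ q x ^ (1 - b) - M` eventually along a filter where `x ^ (1 - b) → ∞`, then
`x ^ b U²` is eventually at least a multiple of `x ^ (2 - b)`. -/
lemma eventually_rpow_le {l : Filter ℝ} {q M : ℝ} (hq : 0 < q)
    (hl : Tendsto (fun x : ℝ => x ^ (1 - b)) l atTop) (hpos : ∀ᶠ x in l, 0 < x)
    (h : ∀ᶠ x in l, q * x ^ (1 - b) - M ≤ U x) :
    ∀ᶠ x in l, (q / 2) ^ 2 * x ^ (2 - b) ≤ x ^ b * U x ^ 2 := by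
  filter_upwards [h, hpos, hl.eventually_ge_atTop (2 * M / q)] with x h1 h2 h3
  rw [div_le_iff₀ hq] at h3
  have h4 : q / 2 * x ^ (1 - b) ≤ U x := by linarith
  have h5 : 0 ≤ q / 2 * x ^ (1 - b) := mul_nonneg (by positivity) (Real.rpow_nonneg h2.le _)
  have e : x ^ (2 - b) = x ^ b * (x ^ (1 - b)) ^ 2 := by
    rw [← Real.rpow_two, ← Real.rpow_mul h2.le, ← Real.rpow_add h2]
    ring_nf
  rw [e]
  calc (q / 2) ^ 2 * (x ^ b * (x ^ (1 - b)) ^ 2) = x ^ b * (q / 2 * x ^ (1 - b)) ^ 2 := by ring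
    _ ≤ _ := mul_le_mul_of_nonneg_left (pow_le_pow_left₀ h5 h4 2) (Real.rpow_nonneg h2.le _)

lemma pos_of_continuousOn_of_ne_zero {s : Set ℝ} (hs : IsPreconnected s) (hU : ContinuousOn U s)
    (h0 : ∀ x ∈ s, U x ≠ 0) {x₀ : ℝ} (hx₀ : x₀ ∈ s) (hpos : 0 < U x₀) : ∀ x ∈ s, 0 < U x := by
  intro x hx
  by_contra h
  obtain ⟨y, hy, hy0⟩ := hs.intermediate_value hx hx₀ hU ⟨not_lt.1 h, hpos.le⟩
  exact h0 y hy hy0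

lemma hasDerivAt_rpow_mul_const (q : ℝ) {x : ℝ} (hx : 0 < x) :
    HasDerivAt (fun x => q * x ^ (1 - b)) (q * (1 - b) * x ^ (-b)) x := by
  refine ((Real.hasDerivAt_rpow_const (p := 1 - b) (Or.inl hx.ne')).const_mul q).congr_deriv ?_
  rw [show 1 - b - 1 = -b by ring]
  ring

variable (hU : ∀ x, 0 < x → HasDerivAt U (x ^ (-b) * V x) x)
  (hV : ∀ x, 0 < x → HasDerivAt V (x ^ b * U x) x)

include hU hV

lemma hasDerivAt_mul_of_system {x : ℝ} (hx : 0 < x) :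
    HasDerivAt (fun x => U x * V x) (x ^ (-b) * V x ^ 2 + x ^ b * U x ^ 2) x := by
  refine ((hU x hx).mul (hV x hx)).congr_deriv ?_
  ring

/-- Consequently a positive value of `U V` propagates to the right and a negative one to the left,
which excludes zeros of `U` there. -/
lemma monotoneOn_mul_of_system : MonotoneOn (fun x => U x * V x) (Ioi 0) := by
  refine monotoneOn_of_deriv_nonneg (convex_Ioi 0)
    (fun x hx => (hasDerivAt_mul_of_system hU hV hx).continuousAt.continuousWithinAt) ?_ ?_
  · rw [interior_Ioi]
    exact fun x hx => (hasDerivAt_mul_of_system hU hV hx).differentiableAt.differentiableWithinAt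
  · rw [interior_Ioi]
    intro x hx
    have hx0 : 0 < x := hx
    rw [(hasDerivAt_mul_of_system hU hV hx).deriv]
    positivity

/-- The contradiction is at infinity, for every `b`. To the right of `x₀` both `U > 0` and `V ≥ V x₀
> 0`. If `-1 ≤ b`, then `U ≥ U x₀` and `x^b` is not integrable at infinity; otherwise `U` grows at
least like `x^(1-b)`, and `x^(2-b)` is not integrable there. -/
lemma false_of_pos_of_system (hi : IntegrableOn (fun x => x ^ b * U x ^ 2) (Ioi 0)) {x₀ : ℝ}
    (hx₀ : 0 < x₀) (hU₀ : 0 < U x₀) (hV₀ : 0 < V x₀) : False := by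
  have hmono := monotoneOn_mul_of_system hU hV
  have hsub : Ici x₀ ⊆ Ioi 0 := fun x hx => hx₀.trans_le hx
  have hUV : ∀ x ∈ Ici x₀, 0 < U x * V x := fun x hx =>
    (mul_pos hU₀ hV₀).trans_le (hmono hx₀ (hsub hx) hx)
  have hUpos : ∀ x ∈ Ici x₀, 0 < U x := pos_of_continuousOn_of_ne_zero isPreconnected_Ici
    (fun x hx => (hU x (hsub hx)).continuousAt.continuousWithinAt)
    (fun x hx h => by simpa [h] using hUV x hx) self_mem_Ici hU₀
  have hVmono : MonotoneOn V (Ici x₀) := by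
    refine monotoneOn_of_hasDerivWithinAt_nonneg (f' := fun x => x ^ b * U x) (convex_Ici x₀)
      (fun x hx => (hV x (hsub hx)).continuousAt.continuousWithinAt)
      (fun x hx => (hV x (hsub (interior_subset hx))).hasDerivWithinAt) fun x hx => ?_
    exact mul_nonneg (Real.rpow_nonneg (le_of_lt (hsub (interior_subset hx))) _)
      (hUpos x (interior_subset hx)).le
  have hVle : ∀ x ∈ Ici x₀, V x₀ ≤ V x := fun x hx => hVmono self_mem_Ici hx hx
  rcases le_or_gt (-1) b with hb | hb
  · have hUmono : MonotoneOn U (Ici x₀) := by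
      refine monotoneOn_of_hasDerivWithinAt_nonneg (f' := fun x => x ^ (-b) * V x) (convex_Ici x₀)
        (fun x hx => (hU x (hsub hx)).continuousAt.continuousWithinAt)
        (fun x hx => (hU x (hsub (interior_subset hx))).hasDerivWithinAt) fun x hx => ?_
      exact mul_nonneg (Real.rpow_nonneg (le_of_lt (hsub (interior_subset hx))) _)
        (hV₀.le.trans (hVle x (interior_subset hx)))
    refine absurd (lt_neg_one_of_rpow_le hi (k := U x₀ ^ 2) (r := b) (by positivity) ?_)
      (not_lt.2 hb)
    filter_upwards [eventually_ge_atTop x₀] with x hx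
    rw [mul_comm]
    exact mul_le_mul_of_nonneg_left (pow_le_pow_left₀ hU₀.le (hUmono self_mem_Ici hx hx) 2)
      (Real.rpow_nonneg (le_of_lt (hsub hx)) _)
  · have hb1 : 0 < 1 - b := by linarith
    -- Chosen so that `q x^(1-b)` has derivative `V x₀ x^(-b)`, a lower bound for `U'`.
    set q := V x₀ / (1 - b)
    have hqb : q * (1 - b) = V x₀ := div_mul_cancel₀ _ hb1.ne'
    have hm : MonotoneOn (fun x => U x - q * x ^ (1 - b)) (Ici x₀) := by
      refine monotoneOn_of_hasDerivWithinAt_nonneg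
        (f' := fun x => x ^ (-b) * V x - q * (1 - b) * x ^ (-b)) (convex_Ici x₀)
        (fun x hx => ((hU x (hsub hx)).sub (hasDerivAt_rpow_mul_const q
          (hsub hx))).continuousAt.continuousWithinAt)
        (fun x hx => ((hU x (hsub (interior_subset hx))).sub (hasDerivAt_rpow_mul_const q
          (hsub (interior_subset hx)))).hasDerivWithinAt) fun x hx => ?_
      rw [hqb]
      have h1 := hVle x (interior_subset hx)
      have h2 : 0 ≤ x ^ (-b) := Real.rpow_nonneg (le_of_lt (hsub (interior_subset hx))) _
      nlinarith
    have hev := eventually_rpow_le (b := b) (U := U) (M := q * x₀ ^ (1 - b)) (q := q)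
      (div_pos hV₀ hb1) (tendsto_rpow_atTop hb1) (eventually_gt_atTop 0) (by
        filter_upwards [eventually_ge_atTop x₀] with x hx
        have := hm self_mem_Ici hx hx
        simp only at this
        linarith)
    have := lt_neg_one_of_rpow_le hi (pow_pos (half_pos (div_pos hV₀ hb1)) 2) hev
    linarith

/-- The mirror argument at `0`, where the restriction on `b` matters. To the left of `x₀` both `U >
0` and `V ≤ V x₀ < 0`. If `b ≤ -1`, then `U ≥ U x₀` and `x^b` is not integrable at `0`; if `3 ≤ b`,
then `U` blows up at least like `x^(1-b)`, and `x^(2-b)` is not integrable at `0`. -/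
lemma false_of_neg_of_system (hb : b ≤ -1 ∨ 3 ≤ b)
    (hi : IntegrableOn (fun x => x ^ b * U x ^ 2) (Ioi 0)) {x₀ : ℝ}
    (hx₀ : 0 < x₀) (hU₀ : 0 < U x₀) (hV₀ : V x₀ < 0) : False := by
  have hmono := monotoneOn_mul_of_system hU hV
  have hsub : Ioc 0 x₀ ⊆ Ioi 0 := fun x hx => hx.1
  have hmem : x₀ ∈ Ioc 0 x₀ := ⟨hx₀, le_rfl⟩
  have hUV : ∀ x ∈ Ioc 0 x₀, U x * V x < 0 := fun x hx =>
    (hmono hx.1 hx₀ hx.2).trans_lt (mul_neg_of_pos_of_neg hU₀ hV₀)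
  have hUpos : ∀ x ∈ Ioc 0 x₀, 0 < U x := pos_of_continuousOn_of_ne_zero isPreconnected_Ioc
    (fun x hx => (hU x (hsub hx)).continuousAt.continuousWithinAt)
    (fun x hx h => by simpa [h] using hUV x hx) hmem hU₀
  have hVmono : MonotoneOn V (Ioc 0 x₀) := by
    refine monotoneOn_of_hasDerivWithinAt_nonneg (f' := fun x => x ^ b * U x) (convex_Ioc 0 x₀)
      (fun x hx => (hV x (hsub hx)).continuousAt.continuousWithinAt)
      (fun x hx => (hV x (hsub (interior_subset hx))).hasDerivWithinAt) fun x hx => ?_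
    exact mul_nonneg (Real.rpow_nonneg (le_of_lt (hsub (interior_subset hx))) _)
      (hUpos x (interior_subset hx)).le
  have hVle : ∀ x ∈ Ioc 0 x₀, V x ≤ V x₀ := fun x hx => hVmono hx hmem hx.2
  have hIoc : ∀ᶠ x in 𝓝[>] (0 : ℝ), x ∈ Ioc 0 x₀ := Ioc_mem_nhdsGT hx₀
  rcases hb with hb | hb
  · have hUanti : AntitoneOn U (Ioc 0 x₀) := by
      refine antitoneOn_of_hasDerivWithinAt_nonpos (f' := fun x => x ^ (-b) * V x)
        (convex_Ioc 0 x₀)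
        (fun x hx => (hU x (hsub hx)).continuousAt.continuousWithinAt)
        (fun x hx => (hU x (hsub (interior_subset hx))).hasDerivWithinAt) fun x hx => ?_
      exact mul_nonpos_of_nonneg_of_nonpos
        (Real.rpow_nonneg (le_of_lt (hsub (interior_subset hx))) _)
        ((hVle x (interior_subset hx)).trans hV₀.le)
    refine absurd (neg_one_lt_of_rpow_le hi (k := U x₀ ^ 2) (r := b) (by positivity) ?_)
      (not_lt.2 hb)
    filter_upwards [hIoc] with x hx
    rw [mul_comm]
    exact mul_le_mul_of_nonneg_left (pow_le_pow_left₀ hU₀.le (hUanti hx hmem hx.2) 2)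
      (Real.rpow_nonneg (le_of_lt hx.1) _)
  · have hb1 : 1 - b < 0 := by linarith
    set q := V x₀ / (1 - b)
    have hqb : q * (1 - b) = V x₀ := div_mul_cancel₀ _ hb1.ne
    have hm : AntitoneOn (fun x => U x - q * x ^ (1 - b)) (Ioc 0 x₀) := by
      refine antitoneOn_of_hasDerivWithinAt_nonpos
        (f' := fun x => x ^ (-b) * V x - q * (1 - b) * x ^ (-b)) (convex_Ioc 0 x₀)
        (fun x hx => ((hU x (hsub hx)).sub (hasDerivAt_rpow_mul_const q
          (hsub hx))).continuousAt.continuousWithinAt)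
        (fun x hx => ((hU x (hsub (interior_subset hx))).sub (hasDerivAt_rpow_mul_const q
          (hsub (interior_subset hx)))).hasDerivWithinAt) fun x hx => ?_
      rw [hqb]
      have h1 := hVle x (interior_subset hx)
      have h2 : 0 ≤ x ^ (-b) := Real.rpow_nonneg (le_of_lt (hsub (interior_subset hx))) _
      nlinarith
    have hq0 : 0 < q := div_pos_of_neg_of_neg hV₀ hb1
    have hev := eventually_rpow_le (b := b) (U := U) (M := q * x₀ ^ (1 - b)) (q := q) hq0
      (tendsto_rpow_neg_nhdsGT_zero hb1) self_mem_nhdsWithin (by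
        filter_upwards [hIoc] with x hx
        have := hm hx hmem hx.2
        simp only at this
        linarith)
    have := neg_one_lt_of_rpow_le hi (pow_pos (half_pos hq0) 2) hev
    linarith

/-- In the limit point case, `u'' + (b/x) u' = u` has no nonzero solution in `L²(x ^ b dx)`. -/
lemma eq_zero_of_system (hb : b ≤ -1 ∨ 3 ≤ b)
    (hi : IntegrableOn (fun x => x ^ b * U x ^ 2) (Ioi 0)) {x : ℝ} (hx : 0 < x) : U x = 0 := by
  have hU' : ∀ x, 0 < x → HasDerivAt (fun x => -U x) (x ^ (-b) * -V x) x := fun x hx => by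
    simpa only [mul_neg] using (hU x hx).fun_neg
  have hV' : ∀ x, 0 < x → HasDerivAt (fun x => -V x) (x ^ b * -U x) x := fun x hx => by
    simpa only [mul_neg] using (hV x hx).fun_neg
  have hi' : IntegrableOn (fun x => x ^ b * (-U x) ^ 2) (Ioi 0) := by simpa only [neg_sq] using hi
  have hzero : ∀ y, 0 < y → U y * V y = 0 := fun y hy => by
    by_contra h
    obtain ⟨hUy, hVy⟩ := mul_ne_zero_iff.1 h
    rcases lt_or_gt_of_ne hUy with h1 | h1 <;> rcases lt_or_gt_of_ne hVy with h2 | h2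
    · exact false_of_pos_of_system hU' hV' hi' hy (neg_pos.2 h1) (neg_pos.2 h2)
    · exact false_of_neg_of_system hU' hV' hb hi' hy (neg_pos.2 h1) (neg_neg_iff_pos.2 h2)
    · exact false_of_neg_of_system hU hV hb hi hy h1 h2
    · exact false_of_pos_of_system hU hV hi hy h1 h2
  -- Since `U V` vanishes identically, so does its derivative, a sum of two nonnegative terms one of
  -- which is `x^b U²`.
  have hloc : (fun x => U x * V x) =ᶠ[𝓝 x] fun _ => 0 := by
    filter_upwards [Ioi_mem_nhds hx] with y hy using hzero y hy
  have h := (hasDerivAt_mul_of_system hU hV hx).unique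
    ((hasDerivAt_const x (0 : ℝ)).congr_of_eventuallyEq hloc)
  have h1 : 0 ≤ x ^ (-b) * V x ^ 2 := by positivity
  have h2 : 0 ≤ x ^ b * U x ^ 2 := by positivity
  have h3 : x ^ b * U x ^ 2 = 0 := by linarith
  exact pow_eq_zero_iff two_ne_zero |>.1
    ((mul_eq_zero.1 h3).resolve_left (Real.rpow_pos_of_pos hx b).ne')

end FirstOrderSystem

lemma ae_eq_zero_of_weak {b : ℝ} (hb : b ≤ -1 ∨ 3 ≤ b) {u : ℝ → ℝ}
    (hu : LocallyIntegrableOn (fun x => x ^ b * u x) (Ioi 0))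
    (hi : IntegrableOn (fun x => x ^ b * u x ^ 2) (Ioi 0))
    (hweak : ∀ φ : RealTestFun, ∫ x in Ioi 0,
      x ^ b * u x * (φ x - (deriv (deriv φ) x + b / x * deriv φ x)) = 0) :
    ∀ᵐ x, x ∈ Ioi (0 : ℝ) → u x = 0 := by
  obtain ⟨U, V, hU, hV, hae⟩ := exists_solution_of_weak hu hweak
  have hi' : IntegrableOn (fun x => x ^ b * U x ^ 2) (Ioi 0) := by
    refine hi.congr_fun_ae ((ae_restrict_iff' measurableSet_Ioi).2 ?_)
    filter_upwards [hae] with x hx hx0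
    rw [hx hx0]
  filter_upwards [hae] with x hx hx0
  rw [hx hx0, eq_zero_of_system hU hV hb hi' hx0]

lemma realTestFun_deriv (φ : RealTestFun) :
    deriv (realTestFun φ φ.contDiff φ.hasCompactSupport φ.tsupport_subset)
      = fun x => ((deriv φ x : ℝ) : ℂ) :=
  funext fun x => (differentiable_realTestFun φ x).hasDerivAt.ofReal_comp.deriv

lemma realTestFun_deriv_deriv (φ : RealTestFun) :
    deriv (deriv (realTestFun φ φ.contDiff φ.hasCompactSupport φ.tsupport_subset))
      = fun x => ((deriv (deriv φ) x : ℝ) : ℂ) := by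
  rw [realTestFun_deriv]
  exact funext fun x => ((contDiff_infty_iff_deriv.1 φ.contDiff).2.differentiable (by simp)
    x).hasDerivAt.ofReal_comp.deriv

/-- In the limit point case the operator is essentially self-adjoint. -/
lemma isEssentiallySelfAdjoint_of_le {b : ℝ} {P : TestFun →ₗ[ℂ] TestFun}
    (hP : ∀ (f : TestFun) (x : ℝ),
      P f x = deriv (deriv f) x + ((b / x : ℝ) : ℂ) * deriv f x)
    (hb : b ≤ -1 ∨ 3 ≤ b) : IsEssentiallySelfAdjoint (unboundedOperator b P) := by
  refine isEssentiallySelfAdjoint_of_nonpos (isDenselySymmetric_unboundedOperator hP)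
    (re_inner_unboundedOperator_nonpos hP) fun u hu => ?_
  have hmem : MemLp u 2 (weightedMeasure b) := Lp.memLp u
  have hweak : ∀ φ : RealTestFun, ∫ x in Ioi 0, x ^ b •
      (starRingEnd ℂ (u x) * ((φ x - (deriv (deriv φ) x + b / x * deriv φ x) : ℝ) : ℂ)) = 0 ∧
      IntegrableOn (fun x => x ^ b • (starRingEnd ℂ (u x) *
        ((φ x - (deriv (deriv φ) x + b / x * deriv φ x) : ℝ) : ℂ))) (Ioi 0) := by
    intro φ
    set f := realTestFun φ φ.contDiff φ.hasCompactSupport φ.tsupport_subset with hf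
    have h := hu ⟨toL2 b f, LinearMap.mem_range_self _ f⟩
    have e : toL2 b f - toL2 b (P f) = (memLp_testFun b (f - P f)).toLp _ :=
      (map_sub (toL2 b) f (P f)).symm
    rw [unboundedOperator_apply] at h
    change inner ℂ u (toL2 b f - toL2 b (P f)) = 0 at h
    have hfun : ((f - P f : TestFun) : ℝ → ℂ) =
        fun x => ((φ x - (deriv (deriv φ) x + b / x * deriv φ x) : ℝ) : ℂ) := by
      funext x
      change f x - P f x = _
      rw [hP, hf, realTestFun_deriv_deriv, realTestFun_deriv]
      change (φ x : ℂ) - _ = _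
      push_cast
      rfl
    rw [e, ← Lp.toLp_coeFn u hmem, inner_toLp, hfun] at h
    have hint := integrableOn_conj_mul hmem (memLp_testFun b (f - P f))
    rw [hfun] at hint
    exact ⟨h, hint⟩
  have hli := locallyIntegrableOn_weight_smul hmem
  have hsq : IntegrableOn (fun x => x ^ b * ‖u x‖ ^ 2) (Ioi 0) := by
    have h := (memLp_two_iff_integrable_sq_norm hmem.1).1 hmem
    exact (integrable_weightedMeasure_iff b _ measurableSet_Ioi le_rfl).1 h.integrableOn
  -- `T` stands for the real or the imaginary part: the coefficients of `L` are real, so each part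
  -- of `conj u` is a real weak solution.
  have hpart : ∀ T : ℂ →L[ℝ] ℝ, (∀ z, |T z| ≤ ‖z‖) →
      (∀ z (r : ℝ), T (starRingEnd ℂ z * r) = T (starRingEnd ℂ z) * r) →
      ∀ᵐ x, x ∈ Ioi (0 : ℝ) → T (starRingEnd ℂ (u x)) = 0 := by
    intro T hT hTr
    have hloc : LocallyIntegrableOn (fun x => x ^ b * T (starRingEnd ℂ (u x))) (Ioi 0) := by
      rw [locallyIntegrableOn_iff isOpen_Ioi.isLocallyClosed] at hli ⊢
      intro k hk hkc
      have := (T.comp Complex.conjCLE.toContinuousLinearMap).integrable_comp (hli k hk hkc)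
      refine this.congr (ae_of_all _ fun x => ?_)
      exact map_smul (T.comp Complex.conjCLE.toContinuousLinearMap) (x ^ b) (u x)
    refine ae_eq_zero_of_weak hb hloc ?_ fun φ => ?_
    · refine Integrable.mono' hsq ?_ ?_
      · have h1 : AEStronglyMeasurable (fun x => x ^ b * T (starRingEnd ℂ (u x)))
            (volume.restrict (Ioi 0)) := hloc.aestronglyMeasurable
        -- Measurability is known for `x^b T(conj u)`; squaring it and multiplying by `x^(-b)` gives
        -- the integrand.
        have h2 := (h1.pow 2).mul
          ((continuousOn_rpow (-b)).aestronglyMeasurable (μ := volume) measurableSet_Ioi)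
        refine h2.congr ((ae_restrict_iff' measurableSet_Ioi).2 (ae_of_all _ fun x hx => ?_))
        have hx0 : 0 < x := hx
        have : x ^ b * x ^ (-b) = 1 := by
          rw [← Real.rpow_add hx0, add_neg_cancel, Real.rpow_zero]
        simp only [Pi.mul_apply, Pi.pow_apply]
        linear_combination x ^ b * T (starRingEnd ℂ (u x)) ^ 2 * this
      · refine (ae_restrict_iff' measurableSet_Ioi).2 (ae_of_all _ fun x hx => ?_)
        have hx0 : 0 < x := hx
        rw [Real.norm_of_nonneg (by positivity)]
        refine mul_le_mul_of_nonneg_left ?_ (Real.rpow_nonneg hx0.le b)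
        rw [← sq_abs]
        refine pow_le_pow_left₀ (abs_nonneg _) ((hT _).trans ?_) 2
        rw [RCLike.norm_conj]
    · obtain ⟨h1, h2⟩ := hweak φ
      have h3 := T.integral_comp_comm h2
      rw [h1, map_zero] at h3
      refine (setIntegral_congr_fun measurableSet_Ioi fun x _ => ?_).trans h3
      simp only [map_smul, hTr, smul_eq_mul]
      ring
  have hre := hpart Complex.reCLM Complex.abs_re_le_norm (fun z r => by simp)
  have him := hpart Complex.imCLM Complex.abs_im_le_norm (fun z r => by simp)
  rw [Lp.eq_zero_iff_ae_eq_zero]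
  refine ae_weightedMeasure_of_ae ?_
  filter_upwards [hre, him] with x h1 h2 hx
  have h1 := h1 hx
  have h2 := h2 hx
  simp only [Complex.reCLM_apply, Complex.imCLM_apply, Complex.conj_re, Complex.conj_im,
    neg_eq_zero] at h1 h2
  exact Complex.ext h1 h2

/-! ### The type of the characteristic point -/

lemma isCharacteristicPoint_zero (a : ℝ) : IsCharacteristicPoint a (0, 0) := by
  ext v
  simp only [distribution, tangentSpace, Submodule.mem_span_pair, LinearMap.mem_ker,
    ContinuousLinearMap.coe_coe, fderiv_defining, chart, X₁, X₂]
  constructor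
  · rintro ⟨r, s, rfl⟩
    simp
  · intro h
    exact ⟨v.1, v.2.1, Prod.ext (by simp) (Prod.ext (by simp) (by simpa using h.symm))⟩

/-- In the coordinates `(x, y)` the characteristic field is itself linear and diagonal, hence equal
to its linearization. -/
lemma linearization_apply (a : ℝ) (p v : ℝ × ℝ) :
    linearization a p v = ((1 / 2 - a) * v.1, (1 / 2 + a) * v.2) := by
  have h : HasFDerivAt (inCoords a (charField a))
      (((1 / 2 - a) • ContinuousLinearMap.fst ℝ ℝ ℝ).prod
        ((1 / 2 + a) • ContinuousLinearMap.snd ℝ ℝ ℝ)) p := by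
    rw [inCoords_charField]
    exact (((1 / 2 - a) • ContinuousLinearMap.fst ℝ ℝ ℝ).prod
        ((1 / 2 + a) • ContinuousLinearMap.snd ℝ ℝ ℝ)).hasFDerivAt
  change fderiv ℝ (inCoords a (charField a)) p v = _
  rw [h.fderiv]
  simp

lemma hasEigenvalue_linearization_sub (a : ℝ) (p : ℝ × ℝ) :
    (linearization a p).HasEigenvalue (1 / 2 - a) :=
  Module.End.hasEigenvalue_of_hasEigenvector (x := (1, 0)) <| Module.End.hasEigenvector_iff.2
    ⟨Module.End.mem_eigenspace_iff.2 (by rw [linearization_apply]; simp), by simp⟩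

lemma hasEigenvalue_linearization_add (a : ℝ) (p : ℝ × ℝ) :
    (linearization a p).HasEigenvalue (1 / 2 + a) :=
  Module.End.hasEigenvalue_of_hasEigenvector (x := (0, 1)) <| Module.End.hasEigenvector_iff.2
    ⟨Module.End.mem_eigenspace_iff.2 (by rw [linearization_apply]; simp), by simp⟩

lemma isProperNode_zero {a : ℝ} (ha : 0 < a) (ha' : a < 1 / 2) : IsProperNode a (0, 0) :=
  ⟨isCharacteristicPoint_zero a, 1 / 2 - a, 1 / 2 + a, by linarith,
    mul_pos (by linarith) (by linarith), hasEigenvalue_linearization_sub a _,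
    hasEigenvalue_linearization_add a _⟩

lemma isSaddle_zero {a : ℝ} (ha : 1 / 2 < a) : IsSaddle a (0, 0) :=
  ⟨isCharacteristicPoint_zero a, 1 / 2 - a, 1 / 2 + a,
    mul_neg_of_neg_of_pos (by linarith) (by linarith), hasEigenvalue_linearization_sub a _,
    hasEigenvalue_linearization_add a _⟩

lemma isStarNode_zero : IsStarNode 0 (0, 0) := by
  refine ⟨isCharacteristicPoint_zero 0, 1 / 2, by norm_num, LinearMap.ext fun v => ?_⟩
  rw [linearization_apply]
  simp [Prod.ext_iff]

/-! ### Translation of the criteria on `b` into conditions on `a` -/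

lemma testLaplacianX_apply {a : ℝ} (ha : a ≠ 1 / 2) (f : TestFun) (x : ℝ) :
    testLaplacianX a f x =
      deriv (deriv f) x + ((1 / (1 / 2 - a) / x : ℝ) : ℂ) * deriv f x := by
  change laplacianX a f x = _
  rw [laplacianX_testFun, if_neg ha, div_div]

lemma testLaplacianY_apply {a : ℝ} (ha : a ≠ -(1 / 2)) (f : TestFun) (x : ℝ) :
    testLaplacianY a f x =
      deriv (deriv f) x + ((1 / (1 / 2 + a) / x : ℝ) : ℂ) * deriv f x := by
  change laplacianY a f x = _
  rw [laplacianY_testFun, if_neg ha, div_div]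

end HeisenbergParaboloid

open HeisenbergParaboloid in
theorem proposition1p1 (a : ℝ) (ha : 0 ≤ a) (ha' : a ≠ 1 / 2) :
    (HeisenbergParaboloid.IsDenselySymmetric (HeisenbergParaboloid.DeltaX a) ∧
      HeisenbergParaboloid.IsDenselySymmetric (HeisenbergParaboloid.DeltaY a)) ∧
    ¬ HeisenbergParaboloid.IsEssentiallySelfAdjoint (HeisenbergParaboloid.DeltaY a) ∧
    (a = 0 → HeisenbergParaboloid.IsStarNode a (0, 0) ∧
      ¬ HeisenbergParaboloid.IsEssentiallySelfAdjoint (HeisenbergParaboloid.DeltaX a)) ∧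
    (0 < a ∧ a < 1 / 6 → HeisenbergParaboloid.IsProperNode a (0, 0) ∧
      ¬ HeisenbergParaboloid.IsEssentiallySelfAdjoint (HeisenbergParaboloid.DeltaX a)) ∧
    (1 / 6 ≤ a ∧ a < 1 / 2 → HeisenbergParaboloid.IsProperNode a (0, 0) ∧
      HeisenbergParaboloid.IsEssentiallySelfAdjoint (HeisenbergParaboloid.DeltaX a)) ∧
    (1 / 2 < a ∧ a ≤ 3 / 2 → HeisenbergParaboloid.IsSaddle a (0, 0) ∧
      HeisenbergParaboloid.IsEssentiallySelfAdjoint (HeisenbergParaboloid.DeltaX a)) ∧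
    (3 / 2 < a → HeisenbergParaboloid.IsSaddle a (0, 0) ∧
      ¬ HeisenbergParaboloid.IsEssentiallySelfAdjoint (HeisenbergParaboloid.DeltaX a)) := by
  have hX := testLaplacianX_apply ha'
  have hY := testLaplacianY_apply (a := a) (by linarith)
  -- The exceptional exponent `1` would need `a = -1/2` here and `a = 1/2` for `Δ_y`.
  have hXne : 1 / (1 / 2 - a) ≠ 1 := fun h => by
    have h0 : 1 / 2 - a ≠ 0 := fun h0 => ha' (by linarith)
    rw [div_eq_one_iff_eq h0] at h
    linarith
  have hYne : 1 / (1 / 2 + a) ≠ 1 := fun h => by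
    rw [div_eq_one_iff_eq (by linarith)] at h
    exact ha' (by linarith)
  have hnode : a < 1 / 6 → ¬ IsEssentiallySelfAdjoint (DeltaX a) := fun h => by
    have hpos : 0 < 1 / 2 - a := by linarith
    refine not_isEssentiallySelfAdjoint_of_lt hX ?_ ?_ hXne
    · linarith [one_div_pos.2 hpos]
    · rw [div_lt_iff₀ hpos]; linarith
  refine ⟨⟨isDenselySymmetric_unboundedOperator hX, isDenselySymmetric_unboundedOperator hY⟩,
    ?_, fun h => ?_, fun h => ?_, fun h => ?_, fun h => ?_, fun h => ?_⟩
  -- As `λ⁺ ≥ 1/2`, the exponent `1/λ⁺` lies in `(0, 2]`, always in the limit circle range.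
  · have hpos : 0 < 1 / 2 + a := by linarith
    refine not_isEssentiallySelfAdjoint_of_lt hY ?_ ?_ hYne
    · linarith [one_div_pos.2 hpos]
    · rw [div_lt_iff₀ hpos]; linarith
  · exact ⟨h ▸ isStarNode_zero, hnode (by linarith)⟩
  · exact ⟨isProperNode_zero h.1 (by linarith [h.2]), hnode h.2⟩
  · refine ⟨isProperNode_zero (by linarith [h.1]) h.2,
      isEssentiallySelfAdjoint_of_le hX (Or.inr ?_)⟩
    rw [le_div_iff₀ (by linarith [h.2])]
    linarith [h.1]
  -- Now `λ⁻ < 0`, so `1/λ⁻ ≤ -1` means `λ⁻ ≥ -1`, i.e. `a ≤ 3/2`; beyond this value the exponent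
  -- lies in `(-1, 0)`.
  · refine ⟨isSaddle_zero h.1, isEssentiallySelfAdjoint_of_le hX (Or.inl ?_)⟩
    rw [div_le_iff_of_neg (by linarith [h.1])]
    linarith [h.2]
  · refine ⟨isSaddle_zero (by linarith), not_isEssentiallySelfAdjoint_of_lt hX ?_ ?_ hXne⟩
    · rw [lt_div_iff_of_neg (by linarith)]
      linarith
    · have : 1 / (1 / 2 - a) < 0 := one_div_neg.2 (by linarith)
      linarith

end
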